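/- Let $m\ge 1$ and let $\mathcal H^{\otimes m}$ be the Hilbert space of $m$ bosonic modes, with orthonormal Fock basis $|\boldsymbol n\rangle=|n_1,\dots,n_m\rangle$, $\boldsymbol n\in\mathbb N^m$ ($0\in\mathbb N$). Let $a_k,a_k^\dagger$ be the operators of mode $k$ with $a_k|\boldsymbol n\rangle=\sqrt{n_k}\,|\dots,n_k-1,\dots\rangle$ and $a_k^\dagger|\boldsymbol n\rangle=\sqrt{n_k+1}\,|\dots,n_k+1,\dots\rangle$, and put $\hat n_k=a_k^\dagger a_k$, $q_k=\frac1{\sqrt2}(a_k+a_k^\dagger)$, $p_k=\frac1{i\sqrt2}(a_k-a_k^\dagger)$. All polynomials in these operators are taken with the linear span of the Fock basis as their domain; a polynomial $P(\boldsymbol q,\boldsymbol p)$ is written with the powers of $q_k$ to the left of those of $p_k$. A polynomial Hamiltonian is a Hermitian (symmetric) operator $P(\boldsymbol q,\boldsymbol p)$. For $N_1,\dots,N_m\in\mathbb N$ let $\mathcal K=\bigotimes_{k=1}^m\mathcal H_{N_k}$ be the span of the $|\boldsymbol n\rangle$ with $n_k\le N_k$ for all $k$. Let $H$ be a Hermitian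 operator on $\mathcal K$. Then there is a polynomial Hamiltonian $P_H(\boldsymbol q,\boldsymbol p)$ with the following properties. 1. (Explicit form) With $L^{N}_{n}(X)=\prod_{0\le l\le N,\,l\ne n}\frac{X-l}{n-l}$, $$P_H(\boldsymbol q,\boldsymbol p)=\sum_{\boldsymbol i,\boldsymbol j}\langle\boldsymbol i|H|\boldsymbol j\rangle\prod_{k=1}^m\sqrt{\tfrac{\min(i_k,j_k)!}{\max(i_k,j_k)!}}\;a_k^{\dagger\,(\max(i_k,j_k)-j_k)}\,L^{N_k}_{\min(i_k,j_k)}(\hat n_k)\,a_k^{\max(i_k,j_k)-i_k},$$ where $\boldsymbol i,\boldsymbol j$ range over the multi-indices with $0\le i_k,j_k\le N_k$. 2. (Degree) If the $N_k$ are all nonzero or all zero, then $\deg P_H\le 3^mN_1\cdots N_m$. In particular, for one mode and every $d=N_1\in\mathbb N$, $\deg P_H\le 3d$. 3. (Block form) $P_H(\boldsymbol q,\boldsymbol p)=H\oplus H'$ for a densely defined Hermitian operator $H'$ on $\mathcal K^\perp$. 4. (Exponentials) $e^{itP_H}=e^{itH}\oplus e^{itH'}$ for all $t\in\mathbb R$,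 in the following sense: the strongly continuous one-parameter unitary groups generated by self-adjoint extensions of $P_H(\boldsymbol q,\boldsymbol p)$ are exactly the groups $e^{itH}\oplus U'_t$, where $U'$ is such a group for $H'$. Consequently $e^{iP_H}|\psi\rangle=e^{iH}|\psi\rangle$ for all $|\psi\rangle\in\mathcal K$, whichever self-adjoint extension is used. Moreover, for $|\psi\rangle\in\mathcal K$, the curve $t\mapsto e^{itH}|\psi\rangle$ is the unique differentiable curve $\varphi:\mathbb R\to\mathcal H^{\otimes m}$ with values in the domain of $P_H(\boldsymbol q,\boldsymbol p)$ that satisfies $\varphi(0)=|\psi\rangle$ and $\varphi'=iP_H(\boldsymbol q,\boldsymbol p)\varphi$. 5. (Complexity) $P_H$ can be computed in polynomial time: a single algorithm, given $m$, $N_1,\dots,N_m$ and the matrix entries $\langle\boldsymbol i|H|\boldsymbol j\rangle$, outputs the list of monomials of $P_H$ with their coefficients in time polynomial in $m+\prod_{k}(N_k+1)$ (so polynomial in $d$ for one mode), where exact arithmetic operations and real square roots on complex numbers have unit cost and integer operations have logarithmic cost. -/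

import Mathlib

/-! ## Fock space of `m` bosonic modes -/

/-- The Hilbert space of `m` modes, `ℓ²(ℕ^m)`; the Fock basis is indexed by occupation numbers. -/
abbrev FockSpace (m : ℕ) : Type := lp (fun _ : Fin m → ℕ => ℂ) 2

/-- The Fock basis vector `|n₁,…,n_m⟩`. -/
noncomputable def ket {m : ℕ} (n : Fin m → ℕ) : FockSpace m := lp.single 2 n 1

/-- Finite linear combinations of Fock basis vectors, as formal combinations. -/
abbrev FinVec (m : ℕ) : Type := (Fin m → ℕ) →₀ ℂ

/-- The inclusion of the finite linear combinations into the Hilbert space. -/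
noncomputable def toFock (m : ℕ) : FinVec m →ₗ[ℂ] FockSpace m :=
  Finsupp.linearCombination ℂ ket

theorem toFock_apply {m : ℕ} (f : FinVec m) (n : Fin m → ℕ) : toFock m f n = f n := by
  classical
  induction f using Finsupp.induction_linear with
  | zero => simp
  | add f g hf hg => simp [map_add, hf, hg]
  | single k c =>
    simp [toFock, ket, Finsupp.single_apply, lp.single_apply, Pi.single_apply, eq_comm]

theorem toFock_injective (m : ℕ) : Function.Injective (toFock m) := by
  intro f g h
  ext n
  rw [← toFock_apply, ← toFock_apply, h]

/-- Annihilation operator of mode `k`: `a |n⟩ = √n |n-1⟩` (which is `0` for `n = 0`). -/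
noncomputable def annihilation {m : ℕ} (k : Fin m) : Module.End ℂ (FinVec m) :=
  Finsupp.linearCombination ℂ fun n : Fin m → ℕ =>
    Finsupp.single (Function.update n k (n k - 1)) ((Real.sqrt (n k) : ℝ) : ℂ)

/-- Creation operator of mode `k`: `a† |n⟩ = √(n+1) |n+1⟩`. -/
noncomputable def creation {m : ℕ} (k : Fin m) : Module.End ℂ (FinVec m) :=
  Finsupp.linearCombination ℂ fun n : Fin m → ℕ =>
    Finsupp.single (Function.update n k (n k + 1)) ((Real.sqrt (n k + 1) : ℝ) : ℂ)

/-- Number operator `n̂ = a† a`. -/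
noncomputable def number {m : ℕ} (k : Fin m) : Module.End ℂ (FinVec m) :=
  creation k * annihilation k

/-- Position operator `q = (a + a†)/√2`. -/
noncomputable def position {m : ℕ} (k : Fin m) : Module.End ℂ (FinVec m) :=
  (1 / ((Real.sqrt 2 : ℝ) : ℂ)) • (annihilation k + creation k)

/-- Momentum operator `p = (a - a†)/(i√2)`. -/
noncomputable def momentum {m : ℕ} (k : Fin m) : Module.End ℂ (FinVec m) :=
  (1 / (Complex.I * ((Real.sqrt 2 : ℝ) : ℂ))) • (annihilation k - creation k)

/-- The operator `P(q₁,p₁,…,q_m,p_m)`. The variables `inl k` and `inr k` stand for `q_k` and `p_k`;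
in each mode the power of `q_k` is written to the left of the power of `p_k`
(operators of different modes commute). -/
noncomputable def polyOp {m : ℕ} (P : MvPolynomial (Fin m ⊕ Fin m) ℂ) :
    Module.End ℂ (FinVec m) :=
  ∑ s ∈ P.support, P.coeff s •
    (List.ofFn fun k : Fin m => position k ^ s (Sum.inl k) * momentum k ^ s (Sum.inr k)).prod

/-- An operator on finite combinations of Fock vectors, regarded as an unbounded operator on the
Hilbert space whose domain is the span of the Fock basis. -/
noncomputable def toUnbounded {m : ℕ} (T : Module.End ℂ (FinVec m)) :
    FockSpace m →ₗ.[ℂ] FockSpace m where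
  domain := LinearMap.range (toFock m)
  toFun := toFock m ∘ₗ T ∘ₗ
    (LinearEquiv.ofInjective (toFock m) (toFock_injective m)).symm.toLinearMap

/-! ## The truncated space -/

/-- The subspace `⨂ₖ H_{N_k}`, spanned by the `|n₁,…,n_m⟩` with `n_k ≤ N_k` for all `k`. -/
noncomputable def cutoffSpace {m : ℕ} (N : Fin m → ℕ) : Submodule ℂ (FockSpace m) :=
  Submodule.span ℂ (Set.range fun i : (k : Fin m) → Fin (N k + 1) => ket fun k => (i k : ℕ))

noncomputable instance cutoffSpaceFinite {m : ℕ} (N : Fin m → ℕ) :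
    FiniteDimensional ℂ (cutoffSpace N) :=
  FiniteDimensional.span_of_finite ℂ (Set.finite_range _)

/-- The Fock basis vectors of the truncated space. -/
noncomputable def cutoffKet {m : ℕ} (N : Fin m → ℕ) (i : (k : Fin m) → Fin (N k + 1)) :
    cutoffSpace N :=
  ⟨ket fun k => (i k : ℕ), Submodule.subset_span ⟨i, rfl⟩⟩

/-- The matrix element `⟨i|H|j⟩`. -/
noncomputable def entry {m : ℕ} {N : Fin m → ℕ} (H : cutoffSpace N →L[ℂ] cutoffSpace N)
    (i j : (k : Fin m) → Fin (N k + 1)) : ℂ :=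
  inner ℂ (cutoffKet N i) (H (cutoffKet N j))

/-! ## The explicit operator -/

/-- The operator
`√(min(i,j)!/max(i,j)!) a†^(max(i,j)-j) L(n̂) a^(max(i,j)-i)` on mode `k`, where `L` is the Lagrange
interpolation polynomial of degree `N` with `L(min(i,j)) = 1` that vanishes at the other integers
of `{0,…,N}`. -/
noncomputable def transitionOp {m : ℕ} (k : Fin m) (N i j : ℕ) : Module.End ℂ (FinVec m) :=
  ((Real.sqrt ((min i j).factorial / (max i j).factorial) : ℝ) : ℂ) •
    (creation k ^ (max i j - j) *
      Polynomial.aeval (number k)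
        (Lagrange.basis (Finset.range (N + 1)) (fun l : ℕ => (l : ℂ)) (min i j)) *
      annihilation k ^ (max i j - i))

/-- The sum over all `i, j` of `⟨i|H|j⟩` times the product of the single-mode operators. -/
noncomputable def interpolationOp {m : ℕ} {N : Fin m → ℕ}
    (H : cutoffSpace N →L[ℂ] cutoffSpace N) : Module.End ℂ (FinVec m) :=
  ∑ i : (k : Fin m) → Fin (N k + 1), ∑ j : (k : Fin m) → Fin (N k + 1),
    entry H i j • (List.ofFn fun k : Fin m => transitionOp k (N k) (i k) (j k)).prod

/-! ## Unbounded operators, direct sums and unitary evolutions -/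

section Operators

variable {E : Type*} [NormedAddCommGroup E] [InnerProductSpace ℂ E]

/-- Hermitian (symmetric and densely defined) operators. -/
def IsHermitianOp (A : E →ₗ.[ℂ] E) : Prop :=
  Dense (A.domain : Set E) ∧ A.IsFormalAdjoint A

/-- `B ⊕ C` for bounded operators `B` on `K` and `C` on the orthogonal complement of `K`. -/
noncomputable def boundedSum (K : Submodule ℂ E) [K.HasOrthogonalProjection]
    (B : K →L[ℂ] K) (C : Kᗮ →L[ℂ] Kᗮ) : E →L[ℂ] E :=
  K.subtypeL ∘L B ∘L K.orthogonalProjectionOnto +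
    Kᗮ.subtypeL ∘L C ∘L Kᗮ.orthogonalProjectionOnto

/-- `B ⊕ C` for a bounded operator `B` on `K` and an unbounded operator `C` on the orthogonal
complement of `K`; its domain is `K ⊕ dom C`. -/
noncomputable def unboundedSum (K : Submodule ℂ E) [K.HasOrthogonalProjection]
    (B : K →L[ℂ] K) (C : Kᗮ →ₗ.[ℂ] Kᗮ) : E →ₗ.[ℂ] E where
  domain := C.domain.comap (Kᗮ.orthogonalProjectionOnto : E →ₗ[ℂ] Kᗮ)
  toFun :=
    K.subtype ∘ₗ (B : K →ₗ[ℂ] K) ∘ₗ (K.orthogonalProjectionOnto : E →ₗ[ℂ] K) ∘ₗ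
        Submodule.subtype _ +
      Kᗮ.subtype ∘ₗ C.toFun ∘ₗ
        (Kᗮ.orthogonalProjectionOnto : E →ₗ[ℂ] Kᗮ).restrict (fun _ hx => hx)

/-- `e^{itB}` for a bounded operator `B`, by the exponential series. -/
noncomputable def expI (B : E →L[ℂ] E) (t : ℝ) : E →L[ℂ] E :=
  NormedSpace.exp ((Complex.I * (t : ℂ)) • B)

/-- `U t = e^{itA}`: `U` is a strongly continuous one-parameter unitary group whose infinitesimal
generator is `iÃ` for a self-adjoint extension `Ã` of `A`. (If `A` is essentially self-adjoint there
is exactly one such `U`; otherwise they correspond to the self-adjoint extensions of `A`.) -/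
structure IsEvolution (A : E →ₗ.[ℂ] E) (U : ℝ → E →L[ℂ] E) : Prop where
  zero : U 0 = ContinuousLinearMap.id ℂ E
  add : ∀ s t, U (s + t) = U s ∘L U t
  inner_map : ∀ t x y, inner ℂ (U t x) (U t y) = inner ℂ x y
  continuous : ∀ x, Continuous fun t => U t x
  generator : ∀ x : A.domain, HasDerivAt (fun t => U t x) (Complex.I • A x) 0

/-- `φ` takes values in the domain of `A` and solves `φ' = i A φ`. -/
def SolvesSchrodinger (A : E →ₗ.[ℂ] E) (φ : ℝ → E) : Prop :=
  ∀ t, ∃ h : φ t ∈ A.domain, HasDerivAt φ (Complex.I • A ⟨φ t, h⟩) t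

end Operators

/-! ## A real RAM

Programs work on finitely many arrays of natural numbers and of (exact) complex numbers. Operations
on complex numbers have unit cost; every natural number that is computed or read is charged its
bit length (logarithmic cost). Control flow is by bounded loops and conditionals, and does not depend
on complex data. -/

namespace RealRAM

/-- `nat a x` and `num a x` are the cells with index `x` of the `a`-th array of each kind. -/
structure State where
  nat : ℕ → ℕ → ℕ
  num : ℕ → ℕ → ℂ

/-- Integer expressions. -/
inductive NatExpr where
  | lit (n : ℕ)
  | load (array : ℕ) (index : NatExpr)
  | add (a b : NatExpr)
  | sub (a b : NatExpr)
  | mul (a b : NatExpr)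
  | div (a b : NatExpr)
  | mod (a b : NatExpr)

def NatExpr.eval (s : State) : NatExpr → ℕ
  | lit n => n
  | load array index => s.nat array (index.eval s)
  | add a b => a.eval s + b.eval s
  | sub a b => a.eval s - b.eval s
  | mul a b => a.eval s * b.eval s
  | div a b => a.eval s / b.eval s
  | mod a b => a.eval s % b.eval s

def NatExpr.cost (s : State) : NatExpr → ℕ
  | lit n => 1 + n.size
  | load array index => index.cost s + 1 + (s.nat array (index.eval s)).size
  | add a b => a.cost s + b.cost s + 1 + (a.eval s + b.eval s).size
  | sub a b => a.cost s + b.cost s + 1 + (a.eval s - b.eval s).size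
  | mul a b => a.cost s + b.cost s + 1 + (a.eval s * b.eval s).size
  | div a b => a.cost s + b.cost s + 1 + (a.eval s / b.eval s).size
  | mod a b => a.cost s + b.cost s + 1 + (a.eval s % b.eval s).size

/-- Complex expressions; `sqrt` is the square root of a nonnegative real number. -/
inductive NumExpr where
  | ofNat (n : NatExpr)
  | imagUnit
  | load (array : ℕ) (index : NatExpr)
  | add (a b : NumExpr)
  | sub (a b : NumExpr)
  | mul (a b : NumExpr)
  | div (a b : NumExpr)
  | sqrt (a : NumExpr)

noncomputable def NumExpr.eval (s : State) : NumExpr → ℂ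
  | ofNat n => (n.eval s : ℂ)
  | imagUnit => Complex.I
  | load array index => s.num array (index.eval s)
  | add a b => a.eval s + b.eval s
  | sub a b => a.eval s - b.eval s
  | mul a b => a.eval s * b.eval s
  | div a b => a.eval s / b.eval s
  | sqrt a => ((Real.sqrt (a.eval s).re : ℝ) : ℂ)

def NumExpr.cost (s : State) : NumExpr → ℕ
  | ofNat n => n.cost s + 1
  | imagUnit => 1
  | load _ index => index.cost s + 1
  | add a b => a.cost s + b.cost s + 1
  | sub a b => a.cost s + b.cost s + 1
  | mul a b => a.cost s + b.cost s + 1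
  | div a b => a.cost s + b.cost s + 1
  | sqrt a => a.cost s + 1

/-- Programs. `forLoop v b p` evaluates `b` once and runs `p` for `i = 0, …, b - 1`, with `i` stored
in cell `0` of the natural number array `v` before each round. -/
inductive Prog where
  | setNat (array : ℕ) (index value : NatExpr)
  | setNum (array : ℕ) (index : NatExpr) (value : NumExpr)
  | seq (p q : Prog)
  | ifLt (a b : NatExpr) (p q : Prog)
  | forLoop (v : ℕ) (bound : NatExpr) (p : Prog)

def State.writeNat (s : State) (array index value : ℕ) : State :=
  { s with nat := Function.update s.nat array (Function.update (s.nat array) index value) }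

def State.writeNum (s : State) (array index : ℕ) (value : ℂ) : State :=
  { s with num := Function.update s.num array (Function.update (s.num array) index value) }

/-- The state after `n` rounds of a loop with body `f` and loop variable `v`. -/
def iterate (v : ℕ) (f : State → State) (s : State) : ℕ → State
  | 0 => s
  | n + 1 => f ((iterate v f s n).writeNat v 0 n)

noncomputable def Prog.exec : Prog → State → State
  | setNat array index value, s => s.writeNat array (index.eval s) (value.eval s)
  | setNum array index value, s => s.writeNum array (index.eval s) (value.eval s)
  | seq p q, s => q.exec (p.exec s)
  | ifLt a b p q, s => if a.eval s < b.eval s then p.exec s else q.exec s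
  | forLoop v bound p, s => iterate v p.exec s (bound.eval s)

/-- The running time of a program. -/
noncomputable def Prog.time : Prog → State → ℕ
  | setNat _ index value, s => index.cost s + value.cost s + 1
  | setNum _ index value, s => index.cost s + value.cost s + 1
  | seq p q, s => p.time s + q.time (p.exec s)
  | ifLt a b p q, s =>
      a.cost s + b.cost s + 1 + if a.eval s < b.eval s then p.time s else q.time s
  | forLoop v bound p, s =>
      bound.cost s + 1 + ∑ i ∈ Finset.range (bound.eval s),
        (1 + i.size + p.time ((iterate v p.exec s i).writeNat v 0 i))

/-- The input `(m, N, H)`: the number of modes is in cell `0` of natural array `0`, the cutoffs `N_k`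
are in natural array `1`, and the matrix of `H` is in complex array `0`, row by row, the rows and
columns being numbered by mixed radix expansion. Nothing is assumed about the other cells. -/
def IsInput {m : ℕ} {N : Fin m → ℕ} (H : cutoffSpace N →L[ℂ] cutoffSpace N) (s : State) : Prop :=
  s.nat 0 0 = m ∧ (∀ k : Fin m, s.nat 1 k = N k) ∧
    ∀ i j : (k : Fin m) → Fin (N k + 1),
      s.num 0 ((finPiFinEquiv i : ℕ) * ∏ k, (N k + 1) + (finPiFinEquiv j : ℕ)) = entry H i j

/-- The exponent vector of the `t`-th monomial of the output: `2m` consecutive cells of natural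
array `3`, the exponents of `q₁,…,q_m` followed by those of `p₁,…,p_m`. -/
noncomputable def outputExponent (m : ℕ) (s : State) (t : ℕ) : (Fin m ⊕ Fin m) →₀ ℕ :=
  Finsupp.equivFunOnFinite.symm
    (Sum.elim (fun k => s.nat 3 (t * (2 * m) + k)) fun k => s.nat 3 (t * (2 * m) + m + k))

/-- The output `P`: a list of distinct monomials with their coefficients. The number of monomials is
in cell `0` of natural array `2`, the coefficients are in complex array `1`. -/
def IsOutput {m : ℕ} (P : MvPolynomial (Fin m ⊕ Fin m) ℂ) (s : State) : Prop :=
  Set.InjOn (outputExponent m s) (Set.Iio (s.nat 2 0)) ∧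
    P = ∑ t ∈ Finset.range (s.nat 2 0), MvPolynomial.monomial (outputExponent m s t) (s.num 1 t)

end RealRAM

/-!
The operator of the pair `(i, j)` in one mode with cutoff `N` takes the occupation number `n` to
`n + i - j`, with a factor `L(x)`, where `L` is the Lagrange polynomial of the node `min i j` and
`x = n - (max i j - i)`. Either `x = min i j`, and then `n = j`; or `L(x) = 0`; or `x > N`, and then
the occupation numbers before and after both exceed `N`. So this operator is the matrix unit
`|i⟩⟨j|` up to the cutoff and does not cross it, and `P_H` acts as `H` on the truncated space and
preserves its orthogonal complement. A solution of the Schrödinger equation of a symmetric operator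
is determined by its initial value, so every evolution generated by an extension of `P_H` agrees
with `e^{itH}` on the truncated space. Newton interpolation turns `L` into a combination of the
operators `a†^s a^s`, whose normal ordered expansions in `q` and `p` are explicit; this gives the
degree and a closed form of every coefficient.
-/

/-! ## Normal ordering in Weyl algebras -/

section Weyl

open Finset LinearMap
open scoped Nat

variable {R A : Type*} [CommRing R] [Ring A] [Algebra R A] {z : R} {q p : A}

theorem weyl_mul_pow (h : p * q = q * p + z • 1) (a : ℕ) :
    p * q ^ a = q ^ a * p + (z * a) • q ^ (a - 1) := by
  induction a with
  | zero => simp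
  | succ a ih =>
    rcases a with _ | a
    · simpa using h
    · rw [pow_succ, ← mul_assoc, ih, add_mul, mul_assoc, h, mul_add, smul_mul_assoc, ← mul_assoc,
        mul_smul_comm, mul_one]
      simp only [Nat.add_sub_cancel, ← pow_succ]
      push_cast
      module

theorem weyl_iterated_commutator (h : p * q = q * p + z • 1) (a c : ℕ) :
    ((mulLeft R p - mulRight R p) ^ c) (q ^ a) = (z ^ c * a.descFactorial c) • q ^ (a - c) := by
  induction c with
  | zero => simp
  | succ c ih =>
    rw [pow_succ', Module.End.mul_apply, ih, map_smul, LinearMap.sub_apply, mulLeft_apply,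
      mulRight_apply, weyl_mul_pow h, add_sub_cancel_left, smul_smul, Nat.sub_sub,
      Nat.descFactorial_succ]
    push_cast
    ring_nf

/-- The coefficient of `q ^ (a - c) * p ^ (b - c)` in the normal ordering of `p ^ b * q ^ a`, where
`p * q = q * p + z`. -/
def swapCoeff (z : R) (b a c : ℕ) : R := z ^ c * b.choose c * a.descFactorial c

theorem weyl_pow_mul_pow (h : p * q = q * p + z • 1) (a b : ℕ) :
    p ^ b * q ^ a = ∑ c ∈ range (b + 1), swapCoeff z b a c • (q ^ (a - c) * p ^ (b - c)) := by
  have hcomm : Commute (mulLeft R p - mulRight R p) (mulRight R p) :=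
    (commute_mulLeft_right p p).sub_left (Commute.refl _)
  have hsplit := hcomm.add_pow b
  rw [sub_add_cancel, pow_mulLeft] at hsplit
  have happly := LinearMap.congr_fun hsplit (q ^ a)
  rw [mulLeft_apply, LinearMap.sum_apply] at happly
  rw [happly]
  refine sum_congr rfl fun c _ => ?_
  rw [(hcomm.pow_pow _ _).eq, ← Nat.cast_comm, ← nsmul_eq_mul, LinearMap.smul_apply,
    Module.End.mul_apply, weyl_iterated_commutator h, pow_mulRight, mulRight_apply, smul_mul_assoc,
    ← Nat.cast_smul_eq_nsmul R, smul_smul, swapCoeff]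
  ring_nf

/-- The normal ordering of `(q + p) ^ k` with all commutators dropped. -/
def normalPow (q p : A) (k : ℕ) : A := ∑ b ∈ range (k + 1), k.choose b • (q ^ (k - b) * p ^ b)

theorem normalPow_eq_pow_apply_one (q p : A) (k : ℕ) :
    normalPow q p k = ((mulLeft R q + mulRight R p) ^ k) 1 := by
  rw [add_comm, (commute_mulLeft_right (R := R) q p).symm.add_pow, LinearMap.sum_apply, normalPow]
  refine sum_congr rfl fun b _ => ?_
  rw [← Nat.cast_comm, ← nsmul_eq_mul, LinearMap.smul_apply, Module.End.mul_apply, pow_mulLeft,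
    pow_mulRight, mulLeft_apply, mulRight_apply, mul_one]

theorem add_mul_normalPow (h : p * q = q * p + z • 1) (k : ℕ) :
    (q + p) * normalPow q p k = normalPow q p (k + 1) + (z * k) • normalPow q p (k - 1) := by
  obtain ⟨D, hD⟩ : ∃ D : Module.End R A, D = mulLeft R p - mulRight R p := ⟨_, rfl⟩
  obtain ⟨S, hS⟩ : ∃ S : Module.End R A, S = mulLeft R q + mulRight R p := ⟨_, rfl⟩
  have hDS : D * S = S * D + z • 1 := by
    ext x
    simp only [hD, hS, Module.End.mul_apply, LinearMap.add_apply, LinearMap.sub_apply,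
      mulLeft_apply, mulRight_apply, LinearMap.smul_apply, Module.End.one_apply, mul_add, add_mul,
      ← mul_assoc, h, smul_mul_assoc, one_mul, mul_sub, sub_mul]
    abel
  have hpow : D * S ^ k = S ^ k * D + (z * k) • S ^ (k - 1) :=
    weyl_mul_pow (A := Module.End R A) hDS k
  have hD1 : D 1 = 0 := by simp [hD]
  have hSD : mulLeft R (q + p) = S + D := by
    ext x
    simp [hS, hD, add_mul]
  simp only [normalPow_eq_pow_apply_one (R := R)]
  rw [← mulLeft_apply R, hSD,
    ← hS, LinearMap.add_apply, ← Module.End.mul_apply, ← Module.End.mul_apply, hpow, ← pow_succ',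
    LinearMap.add_apply, Module.End.mul_apply, hD1, map_zero, zero_add, LinearMap.smul_apply]

theorem choose_mul_doubleFactorial_succ (n c : ℕ) :
    (n + 1).choose (2 * (c + 1)) * (2 * (c + 1) - 1)‼ =
      n.choose (2 * (c + 1)) * (2 * (c + 1) - 1)‼ +
        (n - 2 * c) * (n.choose (2 * c) * (2 * c - 1)‼) := by
  have hodd : (2 * (c + 1) - 1)‼ = (2 * c + 1) * (2 * c - 1)‼ := Nat.doubleFactorial_add_one (2 * c)
  rw [show 2 * (c + 1) = 2 * c + 1 + 1 by ring, Nat.choose_succ_succ] at *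
  rw [hodd]
  linear_combination (2 * c - 1)‼ * Nat.choose_succ_right_eq n (2 * c)

/-- The powers of `q + p` in terms of the normal ordered ones: the coefficients are, up to signs,
those of the Hermite polynomials, the number of ways to choose `c` disjoint pairs among `n`. -/
theorem weyl_add_pow (h : p * q = q * p + z • 1) (n : ℕ) :
    (q + p) ^ n = ∑ c ∈ range (n + 1),
      (z ^ c * (n.choose (2 * c) * (2 * c - 1)‼ : ℕ)) • normalPow q p (n - 2 * c) := by
  induction n with
  | zero => simp [normalPow]
  | succ n ih =>
    have hstep : ∀ c, (q + p) *
        ((z ^ c * (n.choose (2 * c) * (2 * c - 1)‼ : ℕ)) • normalPow q p (n - 2 * c)) =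
        (z ^ c * (n.choose (2 * c) * (2 * c - 1)‼ : ℕ)) • normalPow q p (n + 1 - 2 * c) +
          (z ^ (c + 1) * ((n - 2 * c) * (n.choose (2 * c) * (2 * c - 1)‼) : ℕ)) •
            normalPow q p (n + 1 - 2 * (c + 1)) := by
      intro c
      rcases lt_or_ge n (2 * c) with hlt | hle
      · simp [Nat.choose_eq_zero_of_lt hlt]
      · rw [mul_smul_comm, add_mul_normalPow h, show n - 2 * c + 1 = n + 1 - 2 * c by omega,
          show n - 2 * c - 1 = n + 1 - 2 * (c + 1) by omega, smul_add, smul_smul]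
        push_cast
        ring_nf
    have hsucc : ∑ c ∈ range (n + 1), (z ^ c * (n.choose (2 * c) * (2 * c - 1)‼ : ℕ)) •
        normalPow q p (n + 1 - 2 * c) =
        ∑ c ∈ range (n + 2), (z ^ c * (n.choose (2 * c) * (2 * c - 1)‼ : ℕ)) •
          normalPow q p (n + 1 - 2 * c) := by
      rw [sum_range_succ _ (n + 1), Nat.choose_eq_zero_of_lt (by omega : n < 2 * (n + 1))]
      simp
    rw [pow_succ', ih, mul_sum, sum_congr rfl fun c _ => hstep c, sum_add_distrib, hsucc,
      sum_range_succ' _ (n + 1), sum_range_succ' _ (n + 1), add_right_comm, ← sum_add_distrib]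
    congr 1
    · refine sum_congr rfl fun c _ => ?_
      rw [choose_mul_doubleFactorial_succ, Nat.cast_add, mul_add (z ^ (c + 1)), add_smul]
    · simp

/-- The coefficient of `q ^ (n - 2 * c - b) * p ^ b` in the normal ordering of `(q + l • p) ^ n`,
where `p * q = q * p + z`. -/
def powCoeff (z l : R) (n b c : ℕ) : R :=
  (l * z) ^ c * l ^ b * n.choose (2 * c) * (2 * c - 1)‼ * (n - 2 * c).choose b

theorem weyl_add_smul_pow (h : p * q = q * p + z • 1) (l : R) (n : ℕ) :
    (q + l • p) ^ n = ∑ b ∈ range (n + 1), ∑ c ∈ range (n + 1),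
      powCoeff z l n b c • (q ^ (n - 2 * c - b) * p ^ b) := by
  have hl : (l • p) * q = q * (l • p) + (l * z) • 1 := by
    rw [smul_mul_assoc, h, smul_add, mul_smul_comm, smul_smul]
  rw [weyl_add_pow hl, sum_comm]
  refine sum_congr rfl fun c _ => ?_
  rw [normalPow, smul_sum]
  refine sum_subset_zero_on_sdiff (range_subset_range.2 (by omega)) (fun b hb => ?_)
    fun b _ => ?_
  · have : n - 2 * c < b := by simp at hb; omega
    simp [powCoeff, Nat.choose_eq_zero_of_lt this]
  · rw [smul_pow, mul_smul_comm, ← Nat.cast_smul_eq_nsmul R, smul_smul, smul_smul, powCoeff]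
    push_cast
    ring_nf

end Weyl

/-! ## Newton interpolation -/

section Newton

open Finset Polynomial

variable {K : Type*} [Field K] [CharZero K]

theorem newton_interpolation {P : K[X]} {N : ℕ} (hP : P.degree < (N + 1 : ℕ)) :
    P = ∑ r ∈ range (N + 1),
      C ((fwdDiff 1)^[r] (fun x : ℕ => P.eval (x : K)) 0 / r.factorial) * descPochhammer K r := by
  refine eq_of_degrees_lt_of_eval_index_eq (range (N + 1)) Nat.cast_injective.injOn
    (by rwa [card_range]) ?_ fun x hx => ?_
  · rw [card_range, ← mem_degreeLT]
    refine sum_mem fun r hr => ?_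
    rw [C_mul', mem_degreeLT]
    refine (degree_smul_le _ _).trans_lt (degree_le_natDegree.trans_lt ?_)
    rw [descPochhammer_natDegree]
    exact_mod_cast mem_range.1 hr
  · have hshift := shift_eq_sum_fwdDiff_iter 1 (fun x : ℕ => P.eval (x : K)) x 0
    simp only [smul_eq_mul, mul_one, zero_add] at hshift
    rw [hshift, eval_finsetSum]
    refine sum_subset_zero_on_sdiff (range_subset_range.2 (by simp at hx; omega)) (fun r hr => ?_)
      fun r _ => ?_
    · have hlt : x < r := by simp at hr; omega
      simp [Nat.descFactorial_eq_zero_iff_lt.2 hlt, descPochhammer_eval_eq_descFactorial]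
    · have hr : (r.factorial : K) ≠ 0 := Nat.cast_ne_zero.2 r.factorial_ne_zero
      rw [eval_mul, eval_C, descPochhammer_eval_eq_descFactorial,
        Nat.descFactorial_eq_factorial_mul_choose, nsmul_eq_mul]
      push_cast
      field_simp

/-- The coefficients of the Lagrange polynomial of the node `l` among `0, …, N` in the basis of
falling factorials; they do not depend on `N`. -/
def newtonCoeff (K : Type*) [Field K] (l r : ℕ) : K := (-1) ^ (r + l) * r.choose l / r.factorial

theorem lagrange_basis_eq_sum_newtonCoeff {N l : ℕ} (hl : l ≤ N) :
    Lagrange.basis (range (N + 1)) (fun x : ℕ => (x : K)) l =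
      ∑ r ∈ range (N + 1), C (newtonCoeff K l r) * descPochhammer K r := by
  have hl : l ∈ range (N + 1) := mem_range.2 (Nat.lt_succ_of_le hl)
  have hinj : Set.InjOn (fun x : ℕ => (x : K)) (range (N + 1)) := Nat.cast_injective.injOn
  rw [newton_interpolation (P := Lagrange.basis _ _ l) (N := N)
    (by rw [Lagrange.degree_basis hinj hl, card_range]; exact_mod_cast N.lt_succ_self)]
  refine sum_congr rfl fun r hr => ?_
  congr 2
  rw [fwdDiff_iter_eq_sum_shift, newtonCoeff]
  congr 1
  have hval : ∀ s ∈ range (r + 1), (Lagrange.basis (range (N + 1)) (fun x : ℕ => (x : K)) l).eval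
      ((0 + s • 1 : ℕ) : K) = if s = l then 1 else 0 := by
    intro s hs
    have hs : s ∈ range (N + 1) := by simp at hs hr ⊢; omega
    rw [zero_add, smul_eq_mul, mul_one]
    split_ifs with hsl
    · exact hsl ▸ Lagrange.eval_basis_self hinj hs
    · exact Lagrange.eval_basis_of_ne (Ne.symm hsl) hs
  rw [sum_congr rfl fun s hs => by rw [hval s hs]]
  simp only [smul_ite, smul_zero, sum_ite_eq', mem_range]
  split_ifs with hlr
  · rw [show r + l = r - l + 2 * l by omega, pow_add, pow_mul]
    simp
  · simp [Nat.choose_eq_zero_of_lt (by omega : r < l)]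

end Newton

/-! ## Ladder operators -/

section LadderOperators

open Finset

variable {m : ℕ} (k : Fin m)

theorem creation_single (n : Fin m → ℕ) (c : ℂ) :
    creation k (Finsupp.single n c) =
      Finsupp.single (Function.update n k (n k + 1)) (c * ((Real.sqrt (n k + 1) : ℝ) : ℂ)) := by
  simp [creation]

theorem annihilation_single (n : Fin m → ℕ) (c : ℂ) :
    annihilation k (Finsupp.single n c) =
      Finsupp.single (Function.update n k (n k - 1)) (c * ((Real.sqrt (n k) : ℝ) : ℂ)) := by
  simp [annihilation]

theorem creation_pow_single (u : ℕ) (n : Fin m → ℕ) (c : ℂ) :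
    (creation k ^ u) (Finsupp.single n c) = Finsupp.single (Function.update n k (n k + u))
      (c * ((Real.sqrt ((n k + u).descFactorial u) : ℝ) : ℂ)) := by
  induction u with
  | zero => simp
  | succ u ih =>
    rw [pow_succ', Module.End.mul_apply, ih, creation_single]
    simp only [Function.update_self, Function.update_idem]
    rw [mul_assoc, ← Complex.ofReal_mul, ← Real.sqrt_mul (by positivity), ← Nat.add_assoc,
      Nat.succ_descFactorial_succ]
    push_cast
    rw [mul_comm ((n k : ℝ) + u + 1)]

theorem annihilation_pow_single (v : ℕ) (n : Fin m → ℕ) (c : ℂ) :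
    (annihilation k ^ v) (Finsupp.single n c) = Finsupp.single (Function.update n k (n k - v))
      (c * ((Real.sqrt ((n k).descFactorial v) : ℝ) : ℂ)) := by
  induction v with
  | zero => simp
  | succ v ih =>
    rw [pow_succ', Module.End.mul_apply, ih, annihilation_single]
    simp only [Function.update_self, Function.update_idem]
    rw [mul_assoc, ← Complex.ofReal_mul, ← Real.sqrt_mul (by positivity), Nat.sub_sub,
      Nat.descFactorial_succ]
    push_cast
    rw [mul_comm (((n k - v : ℕ) : ℝ))]

theorem creation_pow_mul_annihilation_pow_single (r : ℕ) (n : Fin m → ℕ)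
    (c : ℂ) : (creation k ^ r * annihilation k ^ r) (Finsupp.single n c) =
      Finsupp.single n (c * ((n k).descFactorial r : ℂ)) := by
  rw [Module.End.mul_apply, annihilation_pow_single, creation_pow_single]
  simp only [Function.update_self, Function.update_idem]
  rcases lt_or_ge (n k) r with h | h
  · simp [Nat.descFactorial_eq_zero_iff_lt.2 h]
  · rw [Nat.sub_add_cancel h, Function.update_eq_self, mul_assoc, ← Complex.ofReal_mul,
      Real.mul_self_sqrt (by positivity)]
    simp

theorem number_single (n : Fin m → ℕ) (c : ℂ) :
    number k (Finsupp.single n c) = Finsupp.single n (c * (n k : ℂ)) := by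
  have := creation_pow_mul_annihilation_pow_single k 1 n c
  simpa [number] using this

theorem aeval_number_single (L : Polynomial ℂ) (n : Fin m → ℕ) (c : ℂ) :
    Polynomial.aeval (number k) L (Finsupp.single n c) =
      Finsupp.single n (c * L.eval (n k : ℂ)) := by
  induction L using Polynomial.induction_on' generalizing c with
  | add f g hf hg => simp [hf, hg, mul_add]
  | monomial r a =>
    have h : ∀ r : ℕ, (number k ^ r) (Finsupp.single n c) =
        Finsupp.single n (c * (n k : ℂ) ^ r) := by
      intro r
      induction r with
      | zero => simp
      | succ r ih =>
        rw [pow_succ', Module.End.mul_apply, ih, number_single, mul_assoc, ← pow_succ]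
    rw [Polynomial.aeval_monomial, Module.End.mul_apply, h]
    simp only [Polynomial.eval_monomial, Module.algebraMap_end_apply, Finsupp.smul_single,
      smul_eq_mul]
    rw [mul_left_comm]

theorem finVec_end_ext {S T : Module.End ℂ (FinVec m)}
    (h : ∀ n c, S (Finsupp.single n c) = T (Finsupp.single n c)) : S = T :=
  Finsupp.lhom_ext h

theorem annihilation_mul_creation :
    annihilation k * creation k = creation k * annihilation k + 1 := by
  refine finVec_end_ext fun n c => ?_
  have h := number_single k n c
  rw [number] at h
  rw [LinearMap.add_apply, h, Module.End.one_apply, Module.End.mul_apply, creation_single,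
    annihilation_single]
  simp only [Function.update_self, Function.update_idem, Nat.add_sub_cancel,
    Function.update_eq_self]
  rw [mul_assoc, ← Complex.ofReal_mul, ← Finsupp.single_add]
  push_cast
  rw [← Complex.ofReal_mul, Real.mul_self_sqrt (by positivity)]
  push_cast
  ring_nf

theorem sqrt_two_ne_zero : ((√2 : ℝ) : ℂ) ≠ 0 := by simp

theorem sqrt_two_sq : ((√2 : ℝ) : ℂ) ^ 2 = 2 := by
  rw [← Complex.ofReal_pow, Real.sq_sqrt zero_le_two, Complex.ofReal_ofNat]

theorem annihilation_eq : annihilation k =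
    (1 / ((√2 : ℝ) : ℂ)) • (position k + Complex.I • momentum k) := by
  have := sqrt_two_ne_zero
  simp only [position, momentum]
  match_scalars <;> field_simp <;> simp only [sqrt_two_sq] <;> ring

theorem creation_eq : creation k =
    (1 / ((√2 : ℝ) : ℂ)) • (position k + -Complex.I • momentum k) := by
  have := sqrt_two_ne_zero
  simp only [position, momentum]
  match_scalars <;> field_simp <;> simp only [sqrt_two_sq] <;> ring

theorem quadrature_mul_quadrature {A : Type*} [Ring A] [Algebra ℂ A] {a c : A}
    (h : a * c = c * a + 1) :
    (1 / (Complex.I * (√2 : ℝ)) : ℂ) • (a - c) * (1 / (√2 : ℝ) : ℂ) • (a + c) =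
      (1 / (√2 : ℝ) : ℂ) • (a + c) * (1 / (Complex.I * (√2 : ℝ)) : ℂ) • (a - c) +
        -Complex.I • 1 := by
  have := sqrt_two_ne_zero
  simp only [smul_mul_smul_comm, add_mul, sub_mul, mul_add, mul_sub, h]
  match_scalars <;> field_simp <;> simp [sqrt_two_sq]; ring

theorem momentum_mul_position : (momentum k : Module.End ℂ (FinVec m)) * position k =
    position k * momentum k + -Complex.I • (1 : Module.End ℂ (FinVec m)) := by
  rw [momentum, position]
  exact quadrature_mul_quadrature (A := Module.End ℂ (FinVec m)) (annihilation_mul_creation k)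

theorem aeval_number_lagrange {N l : ℕ} (hl : l ≤ N) :
    Polynomial.aeval (number k : Module.End ℂ (FinVec m))
        (Lagrange.basis (range (N + 1)) (fun x : ℕ => (x : ℂ)) l) =
      ∑ r ∈ range (N + 1), newtonCoeff ℂ l r • (creation k ^ r * annihilation k ^ r) := by
  refine finVec_end_ext fun n c => ?_
  rw [aeval_number_single, lagrange_basis_eq_sum_newtonCoeff hl]
  simp only [LinearMap.sum_apply, LinearMap.smul_apply, creation_pow_mul_annihilation_pow_single,
    Polynomial.eval_finsetSum, Polynomial.eval_mul, Polynomial.eval_C,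
    descPochhammer_eval_eq_descFactorial, Finsupp.smul_single, smul_eq_mul]
  rw [mul_sum, Finsupp.single_finsetSum]
  refine sum_congr rfl fun r _ => ?_
  ring_nf

end LadderOperators

/-! ## Normal ordered form of the transition operators -/

section NormalForm

open Finset Complex

section Weyl

variable {R A : Type*} [CommRing R] [Ring A] [Algebra R A] {z : R} {q p : A}

/-- The coefficient of `q ^ α * p ^ β` in the normal ordering of
`(q + l • p) ^ u * (q + l' • p) ^ v`, where `p * q = q * p + z`. -/
def powMulPowCoeff (z l l' : R) (u v α β : ℕ) : R :=
  ∑ b ∈ range (u + 1), ∑ b' ∈ range (v + 1), ∑ c ∈ range (u + 1), ∑ c' ∈ range (v + 1),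
    ∑ d ∈ range (b + 1),
      powCoeff z l u b c * powCoeff z l' v b' c' * swapCoeff z b (v - 2 * c' - b') d *
        ((if α = u - 2 * c - b + (v - 2 * c' - b' - d) then 1 else 0) *
          if β = b - d + b' then 1 else 0)

theorem sum_indicator_smul {M : Type*} [AddCommGroup M] [Module R M] {D a b : ℕ} (ha : a < D)
    (hb : b < D) (w : R) (f : ℕ → ℕ → M) :
    ∑ x ∈ range D ×ˢ range D,
      (w * ((if x.1 = a then 1 else 0) * if x.2 = b then 1 else 0)) • f x.1 x.2 = w • f a b := by
  rw [sum_product, sum_eq_single_of_mem a (by simpa), sum_eq_single_of_mem b (by simpa)]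
  · simp
  · intro y _ hy
    simp [hy]
  · intro x _ hx
    simp [hx]

theorem weyl_add_smul_pow_mul (h : p * q = q * p + z • 1) (l l' : R) {u v D : ℕ}
    (hD : u + v < D) :
    (q + l • p) ^ u * (q + l' • p) ^ v =
      ∑ x ∈ range D ×ˢ range D, powMulPowCoeff z l l' u v x.1 x.2 • (q ^ x.1 * p ^ x.2) := by
  have hterm : ∀ b ∈ range (u + 1), ∀ b' ∈ range (v + 1), ∀ c c',
      powCoeff z l u b c • (q ^ (u - 2 * c - b) * p ^ b) *
        powCoeff z l' v b' c' • (q ^ (v - 2 * c' - b') * p ^ b') =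
      ∑ d ∈ range (b + 1), ∑ x ∈ range D ×ˢ range D,
        (powCoeff z l u b c * powCoeff z l' v b' c' * swapCoeff z b (v - 2 * c' - b') d *
          ((if x.1 = u - 2 * c - b + (v - 2 * c' - b' - d) then 1 else 0) *
            if x.2 = b - d + b' then 1 else 0)) • (q ^ x.1 * p ^ x.2) := by
    intro b hb b' hb' c c'
    rw [smul_mul_smul_comm, mul_assoc, ← mul_assoc (p ^ b), weyl_pow_mul_pow h, sum_mul, mul_sum,
      smul_sum]
    refine sum_congr rfl fun d _ => ?_
    simp only [mem_range] at hb hb'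
    rw [sum_indicator_smul (by omega) (by omega) _ fun α β => q ^ α * p ^ β, smul_mul_assoc,
      mul_smul_comm, smul_smul, pow_add, pow_add]
    simp only [mul_assoc]
  simp only [weyl_add_smul_pow h, powMulPowCoeff, sum_smul, sum_mul_sum]
  simp only [sum_comm (s := range D ×ˢ range D)]
  exact sum_congr rfl fun b hb => sum_congr rfl fun b' hb' => sum_congr rfl fun c _ =>
    sum_congr rfl fun c' _ => hterm b hb b' hb' c c'

theorem le_of_powMulPowCoeff_ne_zero {l l' : R} {u v α β : ℕ}
    (h : powMulPowCoeff z l l' u v α β ≠ 0) : α + β ≤ u + v := by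
  obtain ⟨b, hb, h⟩ := exists_ne_zero_of_sum_ne_zero h
  obtain ⟨b', hb', h⟩ := exists_ne_zero_of_sum_ne_zero h
  obtain ⟨c, -, h⟩ := exists_ne_zero_of_sum_ne_zero h
  obtain ⟨c', -, h⟩ := exists_ne_zero_of_sum_ne_zero h
  obtain ⟨d, -, h⟩ := exists_ne_zero_of_sum_ne_zero h
  have hα := left_ne_zero_of_mul (right_ne_zero_of_mul h)
  have hβ := right_ne_zero_of_mul (right_ne_zero_of_mul h)
  simp only [ne_eq, ite_eq_right_iff, not_forall, mem_range] at hα hβ hb hb'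
  obtain ⟨hα, -⟩ := hα
  obtain ⟨hβ, -⟩ := hβ
  omega

end Weyl

variable {m : ℕ} (k : Fin m)

/-- The coefficient of `q ^ α * p ^ β` in the normal ordering of
`creation ^ u * annihilation ^ v`. -/
noncomputable def ladderCoeff (u v α β : ℕ) : ℂ :=
  (1 / ((√2 : ℝ) : ℂ)) ^ (u + v) * powMulPowCoeff (-I) (-I) I u v α β

theorem creation_pow_mul_annihilation_pow {u v D : ℕ} (hD : u + v < D) :
    (creation k ^ u * annihilation k ^ v : Module.End ℂ (FinVec m)) =
      ∑ x ∈ range D ×ˢ range D,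
        ladderCoeff u v x.1 x.2 • (position k ^ x.1 * momentum k ^ x.2) := by
  have hnormal := weyl_add_smul_pow_mul (A := Module.End ℂ (FinVec m))
    (momentum_mul_position k) (-I) I hD
  rw [creation_eq, annihilation_eq, smul_pow, smul_pow, smul_mul_smul_comm, ← pow_add]
  simp only [ladderCoeff, mul_smul, ← smul_sum]
  exact congrArg _ hnormal

/-- The coefficient of `q ^ α * p ^ β` in the normal ordering of `transitionOp k N i j`. -/
noncomputable def modeCoeff (N i j α β : ℕ) : ℂ :=
  ((√((min i j).factorial / (max i j).factorial) : ℝ) : ℂ) *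
    ∑ r ∈ range (N + 1),
      newtonCoeff ℂ (min i j) r * ladderCoeff (max i j - j + r) (max i j - i + r) α β

theorem transitionOp_eq_sum_ladder {N i j : ℕ} (hi : i ≤ N) :
    transitionOp k N i j = ((√((min i j).factorial / (max i j).factorial) : ℝ) : ℂ) •
      ∑ r ∈ range (N + 1), newtonCoeff ℂ (min i j) r •
        (creation k ^ (max i j - j + r) * annihilation k ^ (max i j - i + r)) := by
  rw [transitionOp, aeval_number_lagrange k (min_le_of_left_le hi), mul_sum, sum_mul]
  congr 1
  refine sum_congr rfl fun r _ => ?_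
  rw [mul_smul_comm, smul_mul_assoc, pow_add, add_comm _ r, pow_add]
  simp only [mul_assoc]

theorem transitionOp_eq_sum {N i j : ℕ} (hi : i ≤ N) (hj : j ≤ N) :
    transitionOp k N i j = ∑ x ∈ range (3 * N + 1) ×ˢ range (3 * N + 1),
      modeCoeff N i j x.1 x.2 • (position k ^ x.1 * momentum k ^ x.2) := by
  have hladder : ∀ r ∈ range (N + 1), newtonCoeff ℂ (min i j) r • (creation k ^ (max i j - j + r) *
      annihilation k ^ (max i j - i + r) : Module.End ℂ (FinVec m)) =
      ∑ x ∈ range (3 * N + 1) ×ˢ range (3 * N + 1), (newtonCoeff ℂ (min i j) r *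
        ladderCoeff (max i j - j + r) (max i j - i + r) x.1 x.2) •
          (position k ^ x.1 * momentum k ^ x.2) := by
    intro r hr
    rw [creation_pow_mul_annihilation_pow k (D := 3 * N + 1) (by simp at hr; omega), smul_sum]
    simp only [smul_smul]
  rw [transitionOp_eq_sum_ladder k hi, sum_congr rfl hladder, sum_comm]
  simp only [modeCoeff, mul_smul, sum_smul, smul_sum]

theorem le_of_modeCoeff_ne_zero {N i j α β : ℕ} (hi : i ≤ N) (hj : j ≤ N)
    (h : modeCoeff N i j α β ≠ 0) : α + β ≤ 3 * N := by
  obtain ⟨r, hr, h⟩ := exists_ne_zero_of_sum_ne_zero (right_ne_zero_of_mul h)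
  have hle := le_of_powMulPowCoeff_ne_zero (right_ne_zero_of_mul (right_ne_zero_of_mul h))
  simp only [mem_range] at hr
  omega

end NormalForm

/-! ## Matrix elements of the interpolation operator -/

section MatrixElements

open Finset

theorem eval_lagrange_basis_ofReal (s : Finset ℕ) (l : ℕ) (x : ℝ) :
    (Lagrange.basis s (fun y : ℕ => (y : ℂ)) l).eval (x : ℂ) =
      (((Lagrange.basis s (fun y : ℕ => (y : ℝ)) l).eval x : ℝ) : ℂ) := by
  simp [Lagrange.basis, Lagrange.basisDivisor, Polynomial.eval_prod]

/-- The occupation number into which the transition operator `|i⟩⟨j|` takes `n`, provided that it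
does not annihilate it. -/
def modeTarget (i j n : ℕ) : ℕ := n - (max i j - i) + (max i j - j)

/-- The factor that the transition operator `|i⟩⟨j|` produces on the occupation number `n`. -/
noncomputable def modeWeight (N i j n : ℕ) : ℝ :=
  √((min i j).factorial / (max i j).factorial) *
    (√(n.descFactorial (max i j - i)) *
      (Lagrange.basis (range (N + 1)) (fun x : ℕ => (x : ℝ)) (min i j)).eval
        ((n - (max i j - i) : ℕ) : ℝ) *
      √((modeTarget i j n).descFactorial (max i j - j)))

/-- The matrix element of the transition operator `|i⟩⟨j|` between the occupation numbers `n'` and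
`n`. -/
noncomputable def modeElem (N i j n' n : ℕ) : ℝ :=
  if n' = modeTarget i j n then modeWeight N i j n else 0

theorem transitionOp_single {m : ℕ} (k : Fin m) (N i j : ℕ) (n : Fin m → ℕ) (c : ℂ) :
    transitionOp k N i j (Finsupp.single n c) =
      Finsupp.single (Function.update n k (modeTarget i j (n k)))
        (c * (modeWeight N i j (n k) : ℂ)) := by
  rw [transitionOp, LinearMap.smul_apply, Module.End.mul_apply, Module.End.mul_apply,
    annihilation_pow_single, aeval_number_single, creation_pow_single]
  simp only [Function.update_self, Function.update_idem]
  rw [← Complex.ofReal_natCast (n k - _), eval_lagrange_basis_ofReal, Finsupp.smul_single,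
    smul_eq_mul, modeWeight, modeTarget]
  push_cast
  ring_nf

theorem modeWeight_of_lt {i j n : ℕ} (N : ℕ) (h : n < max i j - i) : modeWeight N i j n = 0 := by
  simp [modeWeight, Nat.descFactorial_eq_zero_iff_lt.2 h]

theorem modeElem_symm (N i j n' n : ℕ) : modeElem N i j n' n = modeElem N j i n n' := by
  rcases lt_or_ge n (max i j - i) with hn | hn
  · rw [modeElem, modeWeight_of_lt N hn, ite_self, modeElem, modeTarget, if_neg (by omega)]
  rcases lt_or_ge n' (max j i - j) with hn' | hn'
  · rw [modeElem.eq_1 N j, modeWeight_of_lt N hn', ite_self, modeElem, modeTarget,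
      if_neg (by omega)]
  by_cases h : n' = modeTarget i j n
  · have h' : n = modeTarget j i n' := by unfold modeTarget at h ⊢; omega
    have hsub : n - (max i j - i) = n' - (max j i - j) := by unfold modeTarget at h; omega
    rw [modeElem, if_pos h, modeElem, if_pos h', modeWeight, modeWeight, ← h, ← h', hsub,
      max_comm j i, min_comm j i]
    ring
  · rw [modeElem, if_neg h, modeElem, if_neg (by unfold modeTarget at h ⊢; omega)]

theorem modeWeight_self {N i j : ℕ} (hj : j ≤ N) : modeWeight N i j j = 1 := by
  have hmin : min i j ∈ range (N + 1) := mem_range.2 (by omega)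
  have hdesc : ∀ x y : ℕ, ((min x y).factorial : ℝ) * y.descFactorial (max x y - x) =
      y.factorial := fun x y => by
    have := Nat.factorial_mul_descFactorial (n := y) (k := max x y - x) (by omega)
    rw [show y - (max x y - x) = min x y by omega] at this
    exact_mod_cast this
  have hi := hdesc j i
  rw [min_comm, max_comm] at hi
  have hmul : ((max i j).factorial : ℝ) * (min i j).factorial = i.factorial * j.factorial := by
    rcases le_total i j with h | h <;> simp [h, mul_comm]
  rw [modeWeight, show j - (max i j - i) = min i j by omega,
    Lagrange.eval_basis_self Nat.cast_injective.injOn hmin, mul_one,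
    show modeTarget i j j = i by unfold modeTarget; omega, ← Real.sqrt_mul (by positivity),
    ← Real.sqrt_mul (by positivity), Real.sqrt_eq_one]
  have hmax : ((max i j).factorial : ℝ) ≠ 0 := Nat.cast_ne_zero.2 (Nat.factorial_ne_zero _)
  refine mul_right_cancel₀ (mul_ne_zero hmax (Nat.cast_ne_zero.2 (min i j).factorial_ne_zero)) ?_
  rw [one_mul]
  nth_rw 2 [hmul]
  rw [← hi, ← hdesc i j]
  field_simp

theorem modeWeight_of_ne {N i j n : ℕ} (hn : n ≤ N) (h : n ≠ j) : modeWeight N i j n = 0 := by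
  rcases lt_or_ge n (max i j - i) with hlt | hle
  · exact modeWeight_of_lt N hlt
  · rw [modeWeight, Lagrange.eval_basis_of_ne (by omega) (mem_range.2 (by omega))]
    simp

theorem modeElem_of_le {N i j n : ℕ} (hj : j ≤ N) (hn : n ≤ N) (n' : ℕ) :
    modeElem N i j n' n = if n = j ∧ n' = i then 1 else 0 := by
  by_cases h : n = j
  · subst h
    simp [modeElem, modeWeight_self hj, show modeTarget i n n = i by unfold modeTarget; omega]
  · simp [modeElem, modeWeight_of_ne hn h, h]

theorem list_map_prod_single {m : ℕ} {T : Fin m → Module.End ℂ (FinVec m)} {φ : Fin m → ℕ → ℕ}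
    {w : Fin m → ℕ → ℂ}
    (hT : ∀ k n c, T k (Finsupp.single n c) =
      Finsupp.single (Function.update n k (φ k (n k))) (c * w k (n k)))
    {l : List (Fin m)} (hl : l.Nodup) (n : Fin m → ℕ) (c : ℂ) :
    (l.map T).prod (Finsupp.single n c) =
      Finsupp.single (fun k => if k ∈ l then φ k (n k) else n k)
        (c * (l.map fun k => w k (n k)).prod) := by
  induction l with
  | nil => simp
  | cons k l ih =>
    obtain ⟨hk, hl⟩ := List.nodup_cons.1 hl
    rw [List.map_cons, List.prod_cons, Module.End.mul_apply, ih hl, hT]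
    simp only [hk, if_false, List.map_cons, List.prod_cons]
    congr 1
    · funext x
      by_cases hx : x = k
      · subst hx; simp
      · simp [hx]
    · ring

theorem list_ofFn_prod_single {m : ℕ} {T : Fin m → Module.End ℂ (FinVec m)} {φ : Fin m → ℕ → ℕ}
    {w : Fin m → ℕ → ℂ}
    (hT : ∀ k n c, T k (Finsupp.single n c) =
      Finsupp.single (Function.update n k (φ k (n k))) (c * w k (n k)))
    (n : Fin m → ℕ) (c : ℂ) :
    (List.ofFn T).prod (Finsupp.single n c) =
      Finsupp.single (fun k => φ k (n k)) (c * ∏ k, w k (n k)) := by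
  rw [List.ofFn_eq_map, list_map_prod_single hT (List.nodup_finRange m), ← List.ofFn_eq_map,
    List.prod_ofFn]
  simp only [List.mem_finRange, if_true]

variable {m : ℕ} {N : Fin m → ℕ}

theorem prod_transitionOp_single_apply (i j : (k : Fin m) → Fin (N k + 1)) (n n' : Fin m → ℕ) :
    (List.ofFn fun k : Fin m => transitionOp k (N k) (i k) (j k)).prod
      (Finsupp.single n (1 : ℂ)) n' =
      ((∏ k, modeElem (N k) (i k) (j k) (n' k) (n k) : ℝ) : ℂ) := by
  rw [list_ofFn_prod_single (φ := fun k => modeTarget (i k) (j k))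
    (w := fun k x => (modeWeight (N k) (i k) (j k) x : ℂ))
    (fun k n c => transitionOp_single k _ _ _ n c), Finsupp.single_apply, one_mul]
  split_ifs with h
  · push_cast
    refine prod_congr rfl fun k _ => ?_
    rw [modeElem, if_pos (congrFun h k).symm]
  · obtain ⟨k, hk⟩ := Function.ne_iff.1 h
    rw [prod_eq_zero (mem_univ k), Complex.ofReal_zero]
    rw [modeElem, if_neg (Ne.symm hk)]

theorem interpolationOp_single_apply (H : cutoffSpace N →L[ℂ] cutoffSpace N)
    (n n' : Fin m → ℕ) :
    interpolationOp H (Finsupp.single n 1) n' =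
      ∑ i : (k : Fin m) → Fin (N k + 1), ∑ j : (k : Fin m) → Fin (N k + 1),
        entry H i j * ((∏ k, modeElem (N k) (i k) (j k) (n' k) (n k) : ℝ) : ℂ) := by
  simp only [interpolationOp, LinearMap.sum_apply, Finsupp.finsetSum_apply, LinearMap.smul_apply,
    Finsupp.smul_apply, prod_transitionOp_single_apply, smul_eq_mul]

theorem entry_conj {H : cutoffSpace N →L[ℂ] cutoffSpace N}
    (hH : (H : cutoffSpace N →ₗ[ℂ] cutoffSpace N).IsSymmetric)
    (i j : (k : Fin m) → Fin (N k + 1)) : (starRingEnd ℂ) (entry H i j) = entry H j i :=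
  (inner_conj_symm (H (cutoffKet N j)) (cutoffKet N i)).trans (hH _ _)

theorem interpolationOp_conj {H : cutoffSpace N →L[ℂ] cutoffSpace N}
    (hH : (H : cutoffSpace N →ₗ[ℂ] cutoffSpace N).IsSymmetric) (n n' : Fin m → ℕ) :
    (starRingEnd ℂ) (interpolationOp H (Finsupp.single n 1) n') =
      interpolationOp H (Finsupp.single n' 1) n := by
  rw [interpolationOp_single_apply, interpolationOp_single_apply, sum_comm]
  simp only [map_sum, map_mul, entry_conj hH, Complex.conj_ofReal]
  refine sum_congr rfl fun j _ => sum_congr rfl fun i _ => ?_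
  simp only [modeElem_symm _ (i _ : ℕ) (j _ : ℕ)]

theorem interpolationOp_single_of_le (H : cutoffSpace N →L[ℂ] cutoffSpace N)
    (j : (k : Fin m) → Fin (N k + 1)) :
    interpolationOp H (Finsupp.single (fun k => (j k : ℕ)) 1) =
      ∑ i : (k : Fin m) → Fin (N k + 1),
        entry H i j • Finsupp.single (fun k => (i k : ℕ)) (1 : ℂ) := by
  classical
  ext n'
  rw [interpolationOp_single_apply]
  simp only [Finsupp.finsetSum_apply, Finsupp.smul_apply, smul_eq_mul, Finsupp.single_apply]
  refine sum_congr rfl fun i _ => ?_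
  have hprod : ∀ j' : (k : Fin m) → Fin (N k + 1),
      ∏ k, modeElem (N k) (i k) (j' k) (n' k) (j k) =
        if j' = j ∧ (fun k => (i k : ℕ)) = n' then 1 else 0 := by
    intro j'
    simp only [modeElem_of_le (Nat.lt_succ_iff.1 (j' _).2) (Nat.lt_succ_iff.1 (j _).2)]
    rw [prod_ite_zero]
    simp only [mem_univ, forall_true_left, prod_const_one]
    congr 1
    simp only [funext_iff, Fin.ext_iff, forall_and, eq_comm]
  simp only [hprod]
  rw [sum_eq_single_of_mem j (mem_univ j) fun j' _ hj' => by simp [hj']]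
  split_ifs <;> simp_all

end MatrixElements

/-! ## The interpolation operator on Fock space -/

section Unbounded

variable {m : ℕ}

theorem inner_ket_left (n : Fin m → ℕ) (x : FockSpace m) : inner ℂ (ket n) x = x n := by
  rw [ket, lp.inner_single_left]
  simp

theorem inner_ket_right (n : Fin m → ℕ) (x : FockSpace m) :
    inner ℂ x (ket n) = (starRingEnd ℂ) (x n) := by
  rw [← inner_conj_symm, inner_ket_left]

theorem toFock_single (n : Fin m → ℕ) (c : ℂ) :
    toFock m (Finsupp.single n c) = c • ket n := by
  simp [toFock]

theorem orthonormal_ket (m : ℕ) : Orthonormal ℂ (ket (m := m)) := by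
  classical
  rw [orthonormal_iff_ite]
  intro n n'
  rw [inner_ket_left, ← one_smul ℂ (ket n'), ← toFock_single, toFock_apply, Finsupp.single_apply]
  simp only [eq_comm]

theorem dense_range_toFock (m : ℕ) :
    Dense (LinearMap.range (toFock m) : Set (FockSpace m)) := by
  classical
  intro x
  have h := lp.hasSum_single (p := 2) (by simp) x
  refine mem_closure_of_tendsto h (Filter.Eventually.of_forall fun s => ?_)
  refine Submodule.sum_mem _ fun n _ => ⟨Finsupp.single n (x n), ?_⟩
  rw [toFock_single, ket, ← lp.single_smul, smul_eq_mul, mul_one]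

theorem toUnbounded_apply (T : Module.End ℂ (FinVec m)) (x : (toUnbounded T).domain)
    (f : FinVec m) (h : (x : FockSpace m) = toFock m f) :
    toUnbounded T x = toFock m (T f) := by
  have : (LinearEquiv.ofInjective (toFock m) (toFock_injective m)).symm x = f :=
    (LinearEquiv.symm_apply_eq _).2 (Subtype.ext h)
  exact congrArg (fun g => toFock m (T g)) this

theorem isHermitianOp_toUnbounded {T : Module.End ℂ (FinVec m)}
    (hT : ∀ n n', (starRingEnd ℂ) (T (Finsupp.single n 1) n') = T (Finsupp.single n' 1) n) :
    IsHermitianOp (toUnbounded T) := by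
  refine ⟨dense_range_toFock m, ?_⟩
  rintro ⟨_, f, rfl⟩ ⟨_, g, rfl⟩
  rw [toUnbounded_apply T _ f rfl, toUnbounded_apply T _ g rfl]
  change inner ℂ (toFock m (T f)) (toFock m g) = inner ℂ (toFock m f) (toFock m (T g))
  induction f using Finsupp.induction_linear with
  | zero => simp
  | add f f' hf hf' => simp only [map_add, inner_add_left, hf, hf']
  | single n c =>
    induction g using Finsupp.induction_linear with
    | zero => simp
    | add g g' hg hg' => simp only [map_add, inner_add_right, hg, hg']
    | single n' c' =>
      rw [← mul_one c, ← smul_eq_mul, ← Finsupp.smul_single, ← mul_one c', ← smul_eq_mul c',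
        ← Finsupp.smul_single]
      simp only [map_smul, inner_smul_left, inner_smul_right, toFock_single, one_smul,
        inner_ket_left, inner_ket_right, toFock_apply, hT]

/-- The Fock basis of the truncated space. -/
noncomputable def cutoffBasis (N : Fin m → ℕ) :
    OrthonormalBasis ((k : Fin m) → Fin (N k + 1)) ℂ (cutoffSpace N) :=
  .mk (v := cutoffKet N)
    (by
      rw [← (cutoffSpace N).subtypeₗᵢ.orthonormal_comp_iff]
      refine (orthonormal_ket m).comp _ fun i j h => funext fun k => Fin.ext ?_
      exact congrFun h k)
    (by
      rw [← Submodule.map_le_map_iff_of_injective (cutoffSpace N).injective_subtype,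
        Submodule.map_span, ← Set.range_comp, Submodule.map_top, Submodule.range_subtype]
      rfl)

theorem cutoffBasis_apply (N : Fin m → ℕ) (i : (k : Fin m) → Fin (N k + 1)) :
    cutoffBasis N i = cutoffKet N i := by
  simp [cutoffBasis]

theorem toFock_sum_cutoffBasis {N : Fin m → ℕ} (x : cutoffSpace N) :
    toFock m (∑ i : (k : Fin m) → Fin (N k + 1),
      inner ℂ (cutoffBasis N i) x • Finsupp.single (fun k => (i k : ℕ)) 1) = x := by
  conv_rhs => rw [← (cutoffBasis N).sum_repr' x]
  simp [toFock_single, cutoffBasis_apply, cutoffKet]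

theorem toUnbounded_interpolationOp_of_mem {N : Fin m → ℕ}
    (H : cutoffSpace N →L[ℂ] cutoffSpace N) (x : cutoffSpace N) :
    ∃ h : (x : FockSpace m) ∈ (toUnbounded (interpolationOp H)).domain,
      toUnbounded (interpolationOp H) ⟨x, h⟩ = H x := by
  refine ⟨⟨_, toFock_sum_cutoffBasis x⟩, ?_⟩
  rw [toUnbounded_apply _ _ _ (toFock_sum_cutoffBasis x).symm]
  conv_rhs => rw [← (cutoffBasis N).sum_repr' x]
  simp only [map_sum, map_smul, AddSubmonoidClass.coe_finsetSum, Submodule.coe_smul]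
  refine Finset.sum_congr rfl fun j _ => congrArg _ ?_
  rw [interpolationOp_single_of_le, ← toFock_sum_cutoffBasis (H _)]
  simp only [cutoffBasis_apply, entry]

end Unbounded

/-! ## The Schrödinger equation -/

section Schrodinger

variable {E : Type*} [NormedAddCommGroup E] [InnerProductSpace ℂ E]

theorem hasDerivAt_clm_apply {F : Type*} [NormedAddCommGroup F] [NormedSpace ℂ F]
    (L : E →L[ℂ] F) {f : ℝ → E} {f' : E} {t : ℝ} (hf : HasDerivAt f f' t) :
    HasDerivAt (fun s => L (f s)) (L f') t :=
  (L.restrictScalars ℝ).hasFDerivAt.comp_hasDerivAt t hf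

variable {A : E →ₗ.[ℂ] E} {φ χ : ℝ → E} {U : ℝ → E →L[ℂ] E}

theorem SolvesSchrodinger.inner_eq (hA : A.IsFormalAdjoint A) (hφ : SolvesSchrodinger A φ)
    (hχ : SolvesSchrodinger A χ) (t : ℝ) : inner ℂ (φ t) (χ t) = inner ℂ (φ 0) (χ 0) := by
  have hderiv : ∀ s, HasDerivAt (fun s => inner ℂ (φ s) (χ s)) 0 s := by
    intro s
    obtain ⟨hφs, hφ'⟩ := hφ s
    obtain ⟨hχs, hχ'⟩ := hχ s
    refine (hφ'.inner ℂ hχ').congr_deriv ?_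
    rw [inner_smul_right, inner_smul_left, hA ⟨φ s, hφs⟩ ⟨χ s, hχs⟩, Complex.conj_I]
    ring
  exact is_const_of_deriv_eq_zero (fun s => (hderiv s).differentiableAt)
    (fun s => (hderiv s).deriv) t 0

theorem SolvesSchrodinger.sub (hφ : SolvesSchrodinger A φ) (hχ : SolvesSchrodinger A χ) :
    SolvesSchrodinger A (φ - χ) := by
  intro t
  obtain ⟨hφt, hφ'⟩ := hφ t
  obtain ⟨hχt, hχ'⟩ := hχ t
  refine ⟨A.domain.sub_mem hφt hχt, (hφ'.sub hχ').congr_deriv ?_⟩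
  rw [← smul_sub, ← A.map_sub]
  rfl

theorem SolvesSchrodinger.eq (hA : A.IsFormalAdjoint A) (hφ : SolvesSchrodinger A φ)
    (hχ : SolvesSchrodinger A χ) (h0 : φ 0 = χ 0) : φ = χ := by
  funext t
  have h := (hφ.sub hχ).inner_eq hA (hφ.sub hχ) t
  rw [Pi.sub_apply, Pi.sub_apply, h0, sub_self, inner_zero_left] at h
  exact sub_eq_zero.1 (inner_self_eq_zero.1 h)

theorem IsEvolution.neg_apply (hU : IsEvolution A U) (t : ℝ) (x : E) : U (-t) (U t x) = x := by
  rw [← ContinuousLinearMap.comp_apply, ← hU.add, neg_add_cancel, hU.zero]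
  rfl

theorem IsEvolution.norm_map (hU : IsEvolution A U) (t : ℝ) (x : E) : ‖U t x‖ = ‖x‖ :=
  (LinearMap.norm_map_iff_inner_map_map (U t)).2 (hU.inner_map t) x

/-- The curve `U (-s) (φ s)` has zero derivative at `t`, because applying the isometry `U s` to its
increment from `t` gives `φ s - U (s - t) (φ t)`, and both terms have derivative `i A (φ t)`. -/
theorem IsEvolution.apply_of_solvesSchrodinger (hU : IsEvolution A U) (hφ : SolvesSchrodinger A φ)
    (t : ℝ) : U t (φ 0) = φ t := by
  have hderiv : ∀ t, HasDerivAt (fun s => U (-s) (φ s)) 0 t := by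
    intro t
    obtain ⟨hφt, hφ'⟩ := hφ t
    have hgen : HasDerivAt (fun s => U (s - t) (φ t)) (Complex.I • A ⟨φ t, hφt⟩) t :=
      HasDerivAt.comp_sub_const t t (by rw [sub_self]; exact hU.generator ⟨φ t, hφt⟩)
    have hdiff := hasDerivAt_iff_isLittleO.1 (hφ'.sub hgen)
    rw [hasDerivAt_iff_isLittleO, ← Asymptotics.isLittleO_norm_left]
    refine hdiff.norm_left.congr_left fun s => ?_
    have hinc : U (-s) (φ s) - U (-t) (φ t) = U (-s) (φ s - U (s - t) (φ t)) := by
      rw [map_sub, ← ContinuousLinearMap.comp_apply (U (-s)), ← hU.add]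
      ring_nf
    rw [smul_zero, sub_zero, hinc, hU.norm_map]
    simp [hU.zero]
  have hconst := is_const_of_deriv_eq_zero (fun s => (hderiv s).differentiableAt)
    (fun s => (hderiv s).deriv) 0 t
  simp only [neg_zero, hU.zero, ContinuousLinearMap.id_apply] at hconst
  rw [hconst]
  simpa using hU.neg_apply (-t) (φ t)

theorem expI_zero (B : E →L[ℂ] E) : expI B 0 = ContinuousLinearMap.id ℂ E := by
  simp only [expI, Complex.ofReal_zero, mul_zero, zero_smul, NormedSpace.exp_zero]
  rfl

variable [CompleteSpace E]

theorem expI_add (B : E →L[ℂ] E) (s t : ℝ) : expI B (s + t) = expI B s ∘L expI B t := by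
  have hcomm : Commute ((Complex.I * (s : ℂ)) • B) ((Complex.I * (t : ℂ)) • B) :=
    ((Commute.refl B).smul_left _).smul_right _
  let _ : NormedAlgebra ℚ (E →L[ℂ] E) := NormedAlgebra.restrictScalars ℚ ℂ _
  rw [expI, Complex.ofReal_add, mul_add, add_smul, NormedSpace.exp_add_of_commute hcomm]
  rfl

theorem hasDerivAt_expI (B : E →L[ℂ] E) (x : E) (t : ℝ) :
    HasDerivAt (fun t => expI B t x) (Complex.I • B (expI B t x)) t := by
  have hexp : ∀ s : ℝ, expI B s = NormedSpace.exp ((s : ℂ) • (Complex.I • B)) := by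
    intro s
    rw [expI, smul_smul, mul_comm]
  have h := (hasDerivAt_exp_smul_const' (𝕂 := ℂ) (Complex.I • B) (t : ℂ)).scomp t
    (Complex.ofRealCLM.hasDerivAt (x := t))
  simp only [hexp]
  refine (ContinuousLinearMap.apply ℂ E x |>.restrictScalars ℝ).hasFDerivAt.comp_hasDerivAt t h
    |>.congr_deriv ?_
  simp

theorem inner_expI {B : E →L[ℂ] E} (hB : (B : E →ₗ[ℂ] E).IsSymmetric) (t : ℝ) (x y : E) :
    inner ℂ (expI B t x) (expI B t y) = inner ℂ x y := by
  have hsolves : ∀ x, SolvesSchrodinger ((B : E →ₗ[ℂ] E).toPMap ⊤) fun t => expI B t x :=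
    fun x t => ⟨trivial, hasDerivAt_expI B x t⟩
  have h := (hsolves x).inner_eq (fun x y => hB x y) (hsolves y) t
  rwa [expI_zero] at h

end Schrodinger

/-! ## Block operators -/

section Blocks

variable {E : Type*} [NormedAddCommGroup E] [InnerProductSpace ℂ E] {K : Submodule ℂ E}

section Compression

variable [K.HasOrthogonalProjection]

theorem orthogonalProjectionOnto_add_coe (a : K) (b : Kᗮ) :
    K.orthogonalProjectionOnto ((a : E) + b) = a := by
  rw [map_add, Submodule.orthogonalProjectionOnto_mem_subspace_eq_self,
    Submodule.orthogonalProjectionOnto_apply_of_mem_orthogonal b.2, add_zero]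

theorem orthogonalProjectionOnto_orthogonal_add_coe (a : K) (b : Kᗮ) :
    Kᗮ.orthogonalProjectionOnto ((a : E) + b) = b := by
  rw [map_add, Submodule.orthogonalProjectionOnto_mem_subspace_eq_self,
    Submodule.orthogonalProjectionOnto_apply_of_mem_orthogonal
      (Submodule.le_orthogonal_orthogonal K a.2), zero_add]

theorem inner_eq_inner_orthogonalProjectionOnto_add (x y : E) :
    inner ℂ x y = inner ℂ (K.orthogonalProjectionOnto x) (K.orthogonalProjectionOnto y) +
      inner ℂ (Kᗮ.orthogonalProjectionOnto x) (Kᗮ.orthogonalProjectionOnto y) := by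
  conv_lhs => rw [← K.starProjection_add_starProjection_orthogonal y]
  rw [inner_add_right, Submodule.starProjection_apply, Submodule.starProjection_apply,
    ← Submodule.inner_orthogonalProjectionOnto_eq_of_mem_right,
    ← Submodule.inner_orthogonalProjectionOnto_eq_of_mem_right]

theorem boundedSum_apply (B : K →L[ℂ] K) (C : Kᗮ →L[ℂ] Kᗮ) (x : E) : boundedSum K B C x =
    (B (K.orthogonalProjectionOnto x) : E) + (C (Kᗮ.orthogonalProjectionOnto x) : E) := rfl

theorem unboundedSum_apply (B : K →L[ℂ] K) (C : Kᗮ →ₗ.[ℂ] Kᗮ) (x : (unboundedSum K B C).domain) :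
    unboundedSum K B C x = (B (K.orthogonalProjectionOnto (x : E)) : E) +
      (C ⟨Kᗮ.orthogonalProjectionOnto (x : E), x.2⟩ : E) := rfl

theorem unboundedSum_coe (B : K →L[ℂ] K) (C : Kᗮ →ₗ.[ℂ] Kᗮ) (x : K) :
    ∃ h : (x : E) ∈ (unboundedSum K B C).domain, unboundedSum K B C ⟨x, h⟩ = B x := by
  have hx : Kᗮ.orthogonalProjectionOnto (x : E) = 0 :=
    Submodule.orthogonalProjectionOnto_apply_of_mem_orthogonal
      (Submodule.le_orthogonal_orthogonal K x.2)
  have hmem : (x : E) ∈ (unboundedSum K B C).domain := by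
    change Kᗮ.orthogonalProjectionOnto (x : E) ∈ C.domain
    rw [hx]
    exact C.domain.zero_mem
  refine ⟨hmem, ?_⟩
  have hC : C ⟨_, hmem⟩ = 0 := (congrArg C (Subtype.ext hx)).trans C.map_zero
  rw [unboundedSum_apply, Submodule.orthogonalProjectionOnto_mem_subspace_eq_self]
  exact (congrArg (fun y : Kᗮ => (B x : E) + y) hC).trans (add_zero _)

theorem unboundedSum_orthogonal_coe (B : K →L[ℂ] K) {C : Kᗮ →ₗ.[ℂ] Kᗮ} (x : C.domain) :
    ∃ h : ((x : Kᗮ) : E) ∈ (unboundedSum K B C).domain, unboundedSum K B C ⟨x, h⟩ = C x := by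
  have hx : Kᗮ.orthogonalProjectionOnto ((x : Kᗮ) : E) = x :=
    Submodule.orthogonalProjectionOnto_mem_subspace_eq_self _
  have hmem : ((x : Kᗮ) : E) ∈ (unboundedSum K B C).domain := by
    change Kᗮ.orthogonalProjectionOnto ((x : Kᗮ) : E) ∈ C.domain
    rw [hx]
    exact x.2
  refine ⟨hmem, ?_⟩
  rw [unboundedSum_apply, Submodule.orthogonalProjectionOnto_apply_of_mem_orthogonal x.1.2,
    map_zero, ZeroMemClass.coe_zero, zero_add]
  exact congrArg (fun y => (C y : E)) (Subtype.ext hx)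

variable (K) in
/-- The compression of an operator `A` to the orthogonal complement of `K`, with domain
`dom A ∩ Kᗮ`. -/
noncomputable def orthogonalCompression (A : E →ₗ.[ℂ] E) : Kᗮ →ₗ.[ℂ] Kᗮ where
  domain := A.domain.comap Kᗮ.subtype
  toFun := (Kᗮ.orthogonalProjectionOnto : E →ₗ[ℂ] Kᗮ) ∘ₗ A.toFun ∘ₗ
    Kᗮ.subtype.restrict (fun _ hx => hx)

variable {A : E →ₗ.[ℂ] E} {H : K →L[ℂ] K}

theorem coe_orthogonalCompression (hA : A.IsFormalAdjoint A)
    (hK : ∀ x : K, ∃ h : (x : E) ∈ A.domain, A ⟨x, h⟩ = H x)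
    (x : (orthogonalCompression K A).domain) :
    (orthogonalCompression K A x : E) = A ⟨x, x.2⟩ := by
  have hmem : A ⟨x, x.2⟩ ∈ Kᗮ := by
    rw [Submodule.mem_orthogonal']
    intro u hu
    obtain ⟨h, hAu⟩ := hK ⟨u, hu⟩
    rw [hA ⟨x, x.2⟩ ⟨u, h⟩, hAu]
    exact (Submodule.mem_orthogonal' _ _).1 (x : Kᗮ).2 _ (H ⟨u, hu⟩).2
  exact congrArg Subtype.val
    (Submodule.orthogonalProjectionOnto_mem_subspace_eq_self (K := Kᗮ) ⟨_, hmem⟩)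

theorem mem_domain_iff_orthogonalProjectionOnto_mem (hK : ∀ x : K, (x : E) ∈ A.domain) (x : E) :
    x ∈ A.domain ↔ (Kᗮ.orthogonalProjectionOnto x : E) ∈ A.domain := by
  conv_lhs => rw [← K.starProjection_add_starProjection_orthogonal x]
  exact Submodule.add_mem_iff_right _ (hK _)

theorem isHermitianOp_orthogonalCompression (hA : IsHermitianOp A)
    (hK : ∀ x : K, ∃ h : (x : E) ∈ A.domain, A ⟨x, h⟩ = H x) :
    IsHermitianOp (orthogonalCompression K A) := by
  refine ⟨?_, fun x y => ?_⟩
  · have hsurj : Function.Surjective Kᗮ.orthogonalProjectionOnto := fun x =>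
      ⟨x, Submodule.orthogonalProjectionOnto_mem_subspace_eq_self x⟩
    refine (hsurj.denseRange.dense_image Kᗮ.orthogonalProjectionOnto.continuous hA.1).mono ?_
    rintro _ ⟨x, hx, rfl⟩
    exact (mem_domain_iff_orthogonalProjectionOnto_mem (fun x => (hK x).1) x).1 hx
  · rw [Submodule.coe_inner, Submodule.coe_inner, coe_orthogonalCompression hA.2 hK,
      coe_orthogonalCompression hA.2 hK]
    exact hA.2 ⟨x, x.2⟩ ⟨y, y.2⟩

theorem eq_unboundedSum_orthogonalCompression (hA : A.IsFormalAdjoint A)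
    (hK : ∀ x : K, ∃ h : (x : E) ∈ A.domain, A ⟨x, h⟩ = H x) :
    A = unboundedSum K H (orthogonalCompression K A) := by
  have hdom := mem_domain_iff_orthogonalProjectionOnto_mem (fun x => (hK x).1)
  refine LinearPMap.ext (Submodule.ext hdom) fun x hx _ => ?_
  obtain ⟨hmem, hAx⟩ := hK (K.orthogonalProjectionOnto x)
  have hsplit : (⟨x, hx⟩ : A.domain) =
      ⟨K.orthogonalProjectionOnto x, hmem⟩ + ⟨Kᗮ.orthogonalProjectionOnto x, (hdom x).1 hx⟩ :=
    Subtype.ext (K.starProjection_add_starProjection_orthogonal x).symm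
  rw [hsplit, A.map_add, hAx, unboundedSum_apply, coe_orthogonalCompression hA hK]

end Compression

variable [CompleteSpace K] {B : K →L[ℂ] K} {C : Kᗮ →ₗ.[ℂ] Kᗮ}

theorem solvesSchrodinger_expI (B : K →L[ℂ] K) (C : Kᗮ →ₗ.[ℂ] Kᗮ) (ψ : K) :
    SolvesSchrodinger (unboundedSum K B C) fun t => (expI B t ψ : E) := by
  intro t
  obtain ⟨hmem, hB⟩ := unboundedSum_coe B C (expI B t ψ)
  refine ⟨hmem, ?_⟩
  rw [hB]
  exact hasDerivAt_clm_apply K.subtypeL (hasDerivAt_expI B ψ t)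

theorem solvesSchrodinger_unboundedSum_iff (hA : (unboundedSum K B C).IsFormalAdjoint
    (unboundedSum K B C)) (ψ : K) (φ : ℝ → E) :
    φ 0 = ψ ∧ SolvesSchrodinger (unboundedSum K B C) φ ↔ ∀ t, φ t = expI B t ψ := by
  refine ⟨fun ⟨h0, hφ⟩ => congrFun (hφ.eq hA (solvesSchrodinger_expI B C ψ) ?_), fun h => ?_⟩
  · rw [h0, expI_zero]
    rfl
  · obtain rfl : φ = fun t => (expI B t ψ : E) := funext h
    refine ⟨?_, solvesSchrodinger_expI B C ψ⟩
    simp only [expI_zero, ContinuousLinearMap.id_apply]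

variable {U : ℝ → E →L[ℂ] E}

theorem IsEvolution.apply_coe (hU : IsEvolution (unboundedSum K B C) U) (ψ : K) (t : ℝ) :
    U t ψ = expI B t ψ := by
  have h := hU.apply_of_solvesSchrodinger (solvesSchrodinger_expI B C ψ) t
  rwa [expI_zero] at h

theorem IsEvolution.apply_mem_orthogonal (hU : IsEvolution (unboundedSum K B C) U) (t : ℝ)
    (x : Kᗮ) : U t x ∈ Kᗮ := by
  rw [Submodule.mem_orthogonal]
  intro u hu
  rw [← hU.inner_map (-t), hU.neg_apply, hU.apply_coe ⟨u, hu⟩]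
  exact (Submodule.mem_orthogonal _ _).1 x.2 _ (expI B (-t) ⟨u, hu⟩).2

theorem IsEvolution.exists_eq_boundedSum (hU : IsEvolution (unboundedSum K B C) U) :
    ∃ V : ℝ → Kᗮ →L[ℂ] Kᗮ, IsEvolution C V ∧ ∀ t, U t = boundedSum K (expI B t) (V t) := by
  let V : ℝ → Kᗮ →L[ℂ] Kᗮ := fun t => Kᗮ.orthogonalProjectionOnto ∘L U t ∘L Kᗮ.subtypeL
  have hV : ∀ t x, (V t x : E) = U t x := fun t x => congrArg Subtype.val
    (Submodule.orthogonalProjectionOnto_mem_subspace_eq_self (K := Kᗮ)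
      ⟨_, hU.apply_mem_orthogonal t x⟩)
  refine ⟨V, ⟨?_, fun s t => ?_, fun t x y => ?_, fun x => ?_, fun x => ?_⟩, fun t => ?_⟩
  · ext x
    rw [hV, hU.zero]
    rfl
  · ext x
    rw [hV, hU.add, ContinuousLinearMap.comp_apply, ContinuousLinearMap.comp_apply, hV, hV]
  · rw [Submodule.coe_inner, Submodule.coe_inner, hV, hV, hU.inner_map]
  · exact Kᗮ.orthogonalProjectionOnto.continuous.comp (hU.continuous x)
  · obtain ⟨hmem, hC⟩ := unboundedSum_orthogonal_coe B x
    refine (hasDerivAt_clm_apply Kᗮ.orthogonalProjectionOnto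
      (hU.generator ⟨_, hmem⟩)).congr_deriv ?_
    rw [hC, map_smul, Submodule.orthogonalProjectionOnto_mem_subspace_eq_self]
  · ext1 x
    rw [boundedSum_apply, hV, ← hU.apply_coe, ← map_add]
    exact congrArg (U t) (K.starProjection_add_starProjection_orthogonal x).symm

theorem isEvolution_boundedSum (hB : (B : K →ₗ[ℂ] K).IsSymmetric) {V : ℝ → Kᗮ →L[ℂ] Kᗮ}
    (hV : IsEvolution C V) :
    IsEvolution (unboundedSum K B C) fun t => boundedSum K (expI B t) (V t) := by
  refine ⟨?_, fun s t => ?_, fun t x y => ?_, fun x => ?_, fun x => ?_⟩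
  · ext1 x
    rw [boundedSum_apply, expI_zero, hV.zero]
    exact K.starProjection_add_starProjection_orthogonal x
  · ext1 x
    rw [ContinuousLinearMap.comp_apply, boundedSum_apply, boundedSum_apply _ _ x, boundedSum_apply,
      orthogonalProjectionOnto_add_coe, orthogonalProjectionOnto_orthogonal_add_coe, expI_add,
      hV.add]
    rfl
  · rw [inner_eq_inner_orthogonalProjectionOnto_add (K := K)]
    simp only [boundedSum_apply, orthogonalProjectionOnto_add_coe,
      orthogonalProjectionOnto_orthogonal_add_coe]
    rw [inner_expI hB, hV.inner_map, ← inner_eq_inner_orthogonalProjectionOnto_add]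
  · refine Continuous.add (continuous_subtype_val.comp ?_)
      (continuous_subtype_val.comp (hV.continuous _))
    exact continuous_iff_continuousAt.2 fun t => (hasDerivAt_expI B _ t).continuousAt
  · have hexp := hasDerivAt_clm_apply K.subtypeL
      (hasDerivAt_expI B (K.orthogonalProjectionOnto (x : E)) 0)
    have hgen := hasDerivAt_clm_apply Kᗮ.subtypeL (hV.generator ⟨_, x.2⟩)
    refine (hexp.add hgen).congr_deriv ?_
    rw [expI_zero, unboundedSum_apply, smul_add]
    rfl

theorem isEvolution_unboundedSum_iff (hB : (B : K →ₗ[ℂ] K).IsSymmetric) :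
    IsEvolution (unboundedSum K B C) U ↔
      ∃ V : ℝ → Kᗮ →L[ℂ] Kᗮ, IsEvolution C V ∧ ∀ t, U t = boundedSum K (expI B t) (V t) := by
  refine ⟨IsEvolution.exists_eq_boundedSum, fun ⟨V, hV, hU⟩ => ?_⟩
  rw [funext hU]
  exact isEvolution_boundedSum hB hV

end Blocks

/-! ## The interpolation polynomial -/

section InterpolationPolynomial

open Finset MvPolynomial

variable {m : ℕ}

theorem polyOp_eq_sum (P : MvPolynomial (Fin m ⊕ Fin m) ℂ)
    {S : Finset ((Fin m ⊕ Fin m) →₀ ℕ)} (hS : P.support ⊆ S) :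
    polyOp P = ∑ s ∈ S, P.coeff s • (List.ofFn fun k : Fin m =>
      position k ^ s (Sum.inl k) * momentum k ^ s (Sum.inr k)).prod :=
  sum_subset hS fun s _ hs => by rw [notMem_support_iff.1 hs, zero_smul]

theorem polyOp_add (P Q : MvPolynomial (Fin m ⊕ Fin m) ℂ) :
    polyOp (P + Q) = polyOp P + polyOp Q := by
  classical
  rw [polyOp_eq_sum (P + Q) support_add, polyOp_eq_sum P subset_union_left,
    polyOp_eq_sum Q subset_union_right, ← sum_add_distrib]
  simp only [coeff_add, add_smul]

theorem polyOp_zero : polyOp (0 : MvPolynomial (Fin m ⊕ Fin m) ℂ) = 0 := by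
  rw [polyOp, support_zero, sum_empty]

theorem polyOp_sum {ι : Type*} (S : Finset ι) (f : ι → MvPolynomial (Fin m ⊕ Fin m) ℂ) :
    polyOp (∑ x ∈ S, f x) = ∑ x ∈ S, polyOp (f x) :=
  map_sum (AddMonoidHom.mk' (⟨polyOp, polyOp_zero⟩ : ZeroHom _ _) polyOp_add) f S

theorem polyOp_monomial (s : (Fin m ⊕ Fin m) →₀ ℕ) (c : ℂ) :
    polyOp (monomial s c) = c • (List.ofFn fun k : Fin m =>
      position k ^ s (Sum.inl k) * momentum k ^ s (Sum.inr k)).prod := by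
  rw [polyOp_eq_sum _ support_monomial_subset, sum_singleton, coeff_monomial, if_pos rfl]

theorem prod_ofFn_sum_smul {R A κ : Type*} [CommSemiring R] [Semiring A] [Algebra R A]
    (S : Fin m → Finset κ) (c : Fin m → κ → R) (g : Fin m → κ → A) :
    (List.ofFn fun k => ∑ x ∈ S k, c k x • g k x).prod =
      ∑ r ∈ Fintype.piFinset S, (∏ k, c k (r k)) • (List.ofFn fun k => g k (r k)).prod := by
  classical
  have h := (MultilinearMap.mkPiAlgebraFin R m A).map_sum_finset (fun k x => c k x • g k x) S
  simp only [MultilinearMap.map_smul_univ, MultilinearMap.mkPiAlgebraFin_apply] at h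
  exact h

theorem sum_le_prod_of_two_le {ι : Type*} {s : Finset ι} {a : ι → ℕ} (ha : ∀ x ∈ s, 2 ≤ a x) :
    ∑ x ∈ s, a x ≤ ∏ x ∈ s, a x := by
  classical
  induction s using Finset.induction_on with
  | empty => simp
  | insert x s hx ih =>
    obtain ⟨hax, has⟩ := forall_mem_insert _ _ _ |>.1 ha
    rw [sum_insert hx, prod_insert hx]
    rcases s.eq_empty_or_nonempty with rfl | ⟨y, hy⟩
    · simp
    · have hsum : 2 ≤ ∑ x ∈ s, a x :=
        (has y hy).trans (single_le_sum_of_canonicallyOrdered hy)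
      exact (Nat.add_le_mul hax hsum).trans (Nat.mul_le_mul_left _ (ih has))

variable {N : Fin m → ℕ} (H : cutoffSpace N →L[ℂ] cutoffSpace N)

/-- The families of exponents `(α_k, β_k)` with `α_k, β_k ≤ 3 N_k`, which contain the exponents of
`q_k` and `p_k` in every monomial of `interpolationPoly`. -/
def exponentRange (N : Fin m → ℕ) : Finset (Fin m → ℕ × ℕ) :=
  Fintype.piFinset fun k => range (3 * N k + 1) ×ˢ range (3 * N k + 1)

/-- The exponent vector of the monomial in which `q_k` and `p_k` have the exponents `r k`. -/
noncomputable def pairExponent (r : Fin m → ℕ × ℕ) : (Fin m ⊕ Fin m) →₀ ℕ :=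
  Finsupp.equivFunOnFinite.symm (Sum.elim (fun k => (r k).1) fun k => (r k).2)

/-- The coefficient of the monomial with exponents `r` in `interpolationPoly H`. -/
noncomputable def interpolationCoeff (r : Fin m → ℕ × ℕ) : ℂ :=
  ∑ i : (k : Fin m) → Fin (N k + 1), ∑ j : (k : Fin m) → Fin (N k + 1),
    entry H i j * ∏ k, modeCoeff (N k) (i k) (j k) (r k).1 (r k).2

/-- The polynomial Hamiltonian `P_H`, with the powers of `q_k` to the left of those of `p_k`. -/
noncomputable def interpolationPoly : MvPolynomial (Fin m ⊕ Fin m) ℂ :=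
  ∑ r ∈ exponentRange N, monomial (pairExponent r) (interpolationCoeff H r)

theorem prod_ofFn_transitionOp (i j : (k : Fin m) → Fin (N k + 1)) :
    (List.ofFn fun k : Fin m => transitionOp k (N k) (i k) (j k)).prod =
      ∑ r ∈ exponentRange N, (∏ k, modeCoeff (N k) (i k) (j k) (r k).1 (r k).2) •
        (List.ofFn fun k : Fin m => position k ^ (r k).1 * momentum k ^ (r k).2).prod := by
  rw [exponentRange, ← prod_ofFn_sum_smul (fun k => range (3 * N k + 1) ×ˢ range (3 * N k + 1))
    (fun k x => modeCoeff (N k) (i k) (j k) x.1 x.2)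
    (fun k x => (position k ^ x.1 * momentum k ^ x.2 : Module.End ℂ (FinVec m)))]
  congr 2
  funext k
  exact transitionOp_eq_sum k (Nat.lt_succ_iff.1 (i k).2) (Nat.lt_succ_iff.1 (j k).2)

theorem polyOp_interpolationPoly : polyOp (interpolationPoly H) = interpolationOp H := by
  rw [interpolationPoly, polyOp_sum, interpolationOp]
  simp only [prod_ofFn_transitionOp, polyOp_monomial, interpolationCoeff, sum_smul, mul_smul,
    smul_sum]
  rw [sum_comm]
  refine sum_congr rfl fun i _ => ?_
  rw [sum_comm]
  rfl

theorem totalDegree_interpolationPoly_le_sum :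
    (interpolationPoly H).totalDegree ≤ ∑ k, 3 * N k := by
  refine totalDegree_finsetSum_le fun r _ => ?_
  by_cases hc : interpolationCoeff H r = 0
  · rw [hc, monomial_zero, totalDegree_zero]
    exact Nat.zero_le _
  obtain ⟨i, -, hi⟩ := exists_ne_zero_of_sum_ne_zero hc
  obtain ⟨j, -, hj⟩ := exists_ne_zero_of_sum_ne_zero hi
  have hk := fun k => prod_ne_zero_iff.1 (right_ne_zero_of_mul hj) k (mem_univ k)
  rw [totalDegree_monomial _ hc, Finsupp.sum_fintype _ _ fun _ => rfl,
    Fintype.sum_sum_type, ← sum_add_distrib]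
  exact sum_le_sum fun k _ => le_of_modeCoeff_ne_zero (Nat.lt_succ_iff.1 (i k).2)
    (Nat.lt_succ_iff.1 (j k).2) (hk k)

theorem totalDegree_interpolationPoly_le_prod (hN : (∀ k, N k ≠ 0) ∨ ∀ k, N k = 0) :
    (interpolationPoly H).totalDegree ≤ 3 ^ m * ∏ k, N k := by
  refine (totalDegree_interpolationPoly_le_sum H).trans ?_
  rcases hN with hN | hN
  · refine (sum_le_prod_of_two_le fun k _ => ?_).trans_eq ?_
    · have := hN k
      omega
    · rw [prod_mul_distrib, prod_const, card_univ, Fintype.card_fin]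
  · simp [hN]

end InterpolationPolynomial

/-! ## The polynomial as a list of monomials -/

namespace RealRAM

open Finset

/-- The digit with index `k` of `t` in the mixed radix system with radices `R`, from the least
significant digit on. -/
def digit (R : ℕ → ℕ) (t k : ℕ) : ℕ := t / (∏ l ∈ range k, R l) % R k

theorem digit_finPiFinEquiv {n : ℕ} (R : ℕ → ℕ) (x : (k : Fin n) → Fin (R k)) (k : Fin n) :
    digit R (finPiFinEquiv x : ℕ) k = x k := by
  conv_rhs => rw [← finPiFinEquiv.symm_apply_apply x]
  rw [digit, prod_range]
  rfl

theorem sum_range_prod {M : Type*} [AddCommMonoid M] {n : ℕ} (R : ℕ → ℕ) (f : ℕ → M) :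
    ∑ t ∈ range (∏ l ∈ range n, R l), f t =
      ∑ x : (k : Fin n) → Fin (R k), f (finPiFinEquiv x : ℕ) := by
  rw [prod_range, sum_range, ← Equiv.sum_comp finPiFinEquiv]

theorem exists_finPiFinEquiv_eq {n : ℕ} {R : ℕ → ℕ} {t : ℕ} (ht : t < ∏ l ∈ range n, R l) :
    ∃ x : (k : Fin n) → Fin (R k), (finPiFinEquiv x : ℕ) = t := by
  rw [prod_range] at ht
  exact ⟨finPiFinEquiv.symm ⟨t, ht⟩, by rw [Equiv.apply_symm_apply]⟩

/-- The radices in which the number of a monomial is written: `2m` digits, the exponents of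
`q_1, …, q_m` followed by those of `p_1, …, p_m`. -/
def radix (m : ℕ) (N : ℕ → ℕ) (l : ℕ) : ℕ := 3 * N (l % m) + 1

variable {m : ℕ} (N : ℕ → ℕ)

theorem radix_pos (m : ℕ) (N : ℕ → ℕ) (l : ℕ) : 0 < radix m N l := Nat.succ_pos _

theorem radix_castAdd (k : Fin m) : radix m N (Fin.castAdd m k) = 3 * N k + 1 := by
  rw [radix, Fin.val_castAdd, Nat.mod_eq_of_lt k.2]

theorem radix_natAdd (k : Fin m) : radix m N (Fin.natAdd m k) = 3 * N k + 1 := by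
  rw [radix, Fin.val_natAdd, Nat.add_mod_left, Nat.mod_eq_of_lt k.2]

theorem prod_radix (m : ℕ) :
    ∏ l ∈ range (m + m), radix m N l = (∏ l ∈ range m, (3 * N l + 1)) ^ 2 := by
  rw [prod_range, Fin.prod_univ_add, sq]
  simp only [radix_castAdd, radix_natAdd, prod_range]

theorem prod_radix_le (m : ℕ) :
    ∏ l ∈ range (m + m), radix m N l ≤ (∏ l ∈ range m, (N l + 1)) ^ 6 := by
  have hle : ∏ l ∈ range m, (3 * N l + 1) ≤ (∏ l ∈ range m, (N l + 1)) ^ 3 := by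
    rw [← prod_pow]
    exact prod_le_prod' fun l _ => by nlinarith [Nat.zero_le (N l ^ 3 + 3 * N l ^ 2)]
  rw [prod_radix]
  exact (Nat.pow_le_pow_left hle 2).trans_eq (pow_mul _ 3 2).symm

/-- The exponents `(α_k, β_k)` in the monomial with number `t`. -/
def digitPair (m : ℕ) (N : ℕ → ℕ) (t : ℕ) (k : Fin m) : ℕ × ℕ :=
  (digit (radix m N) t k, digit (radix m N) t (m + k))

theorem digitPair_finPiFinEquiv (x : (l : Fin (m + m)) → Fin (radix m N l)) (k : Fin m) :
    digitPair m N (finPiFinEquiv x) k = (↑(x (Fin.castAdd m k)), ↑(x (Fin.natAdd m k))) :=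
  Prod.ext (digit_finPiFinEquiv (radix m N) x (Fin.castAdd m k))
    (digit_finPiFinEquiv (radix m N) x (Fin.natAdd m k))

theorem digitPair_mem_exponentRange (t : ℕ) :
    digitPair m N t ∈ exponentRange fun k : Fin m => N k := by
  refine Fintype.mem_piFinset.2 fun k => ?_
  rw [mem_product, mem_range, mem_range]
  exact ⟨radix_castAdd N k ▸ Nat.mod_lt _ (radix_pos m N _),
    radix_natAdd N k ▸ Nat.mod_lt _ (radix_pos m N _)⟩

theorem injOn_digitPair :
    Set.InjOn (digitPair m N) (Set.Iio (∏ l ∈ range (m + m), radix m N l)) := by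
  intro t ht t' ht' h
  obtain ⟨x, rfl⟩ := exists_finPiFinEquiv_eq ht
  obtain ⟨y, rfl⟩ := exists_finPiFinEquiv_eq ht'
  have hxy : ∀ k : Fin m, _ := fun k => Prod.ext_iff.1 (congrFun h k)
  simp only [digitPair_finPiFinEquiv] at hxy
  suffices x = y by rw [this]
  funext l
  induction l using Fin.addCases with
  | left k => exact Fin.ext (hxy k).1
  | right k => exact Fin.ext (hxy k).2

theorem surjOn_digitPair : Set.SurjOn (digitPair m N)
    (Set.Iio (∏ l ∈ range (m + m), radix m N l)) (exponentRange fun k : Fin m => N k) := by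
  intro r hr
  have hr k := mem_product.1 (Fintype.mem_piFinset.1 hr k)
  simp only [mem_range] at hr
  let x (l : Fin (m + m)) : Fin (radix m N l) :=
    Fin.addCases (motive := fun l => Fin (radix m N l))
      (fun k => ⟨(r k).1, (radix_castAdd N k).symm ▸ (hr k).1⟩)
      (fun k => ⟨(r k).2, (radix_natAdd N k).symm ▸ (hr k).2⟩) l
  refine ⟨finPiFinEquiv x, ?_, funext fun k => ?_⟩
  · rw [Set.mem_Iio, prod_range]
    exact Fin.is_lt _
  · rw [digitPair_finPiFinEquiv]
    simp only [x, Fin.addCases_left, Fin.addCases_right]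

theorem sum_digitPair {M : Type*} [AddCommMonoid M] (f : (Fin m → ℕ × ℕ) → M) :
    ∑ t ∈ range (∏ l ∈ range (m + m), radix m N l), f (digitPair m N t) =
      ∑ r ∈ exponentRange fun k : Fin m => N k, f r := by
  refine sum_nbij (digitPair m N) (fun t _ => digitPair_mem_exponentRange N t) ?_ ?_
    fun _ _ => rfl
  · rw [coe_range]
    exact injOn_digitPair N
  · rw [coe_range]
    exact surjOn_digitPair N

/-- The coefficient of the monomial with number `t`, as a formula in the input: `h` lists the matrix
of `H` as in `IsInput`. -/
noncomputable def coeffAt (m : ℕ) (N : ℕ → ℕ) (h : ℕ → ℂ) (t : ℕ) : ℂ :=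
  ∑ i ∈ range (∏ l ∈ range m, (N l + 1)), ∑ j ∈ range (∏ l ∈ range m, (N l + 1)),
    h (i * (∏ l ∈ range m, (N l + 1)) + j) *
      ∏ k ∈ range m, modeCoeff (N k) (digit (fun l => N l + 1) i k) (digit (fun l => N l + 1) j k)
        (digit (radix m N) t k) (digit (radix m N) t (m + k))

theorem pairExponent_injective :
    Function.Injective (pairExponent : (Fin m → ℕ × ℕ) → _) := by
  intro r r' h
  funext k
  exact Prod.ext (DFunLike.congr_fun h (Sum.inl k)) (DFunLike.congr_fun h (Sum.inr k))

variable {N} {H : cutoffSpace (fun k : Fin m => N k) →L[ℂ] cutoffSpace fun k : Fin m => N k}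
  {s s' : State}

theorem IsInput.coeffAt_eq (hs : IsInput H s) (t : ℕ) :
    coeffAt m N (s.num 0) t = interpolationCoeff H (digitPair m N t) := by
  rw [coeffAt, sum_range_prod fun l => N l + 1]
  refine sum_congr rfl fun i _ => ?_
  rw [sum_range_prod fun l => N l + 1]
  refine sum_congr rfl fun j _ => ?_
  rw [prod_range, hs.2.2, prod_range]
  refine congrArg _ (prod_congr rfl fun k _ => ?_)
  rw [digit_finPiFinEquiv (fun l => N l + 1) i, digit_finPiFinEquiv (fun l => N l + 1) j]
  rfl

theorem outputExponent_eq {t : ℕ}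
    (hexp : ∀ l < m + m, s.nat 3 (t * (m + m) + l) = digit (radix m N) t l) :
    outputExponent m s t = pairExponent (digitPair m N t) := by
  rw [outputExponent, pairExponent, two_mul]
  congr 2
  · funext k
    exact hexp k (by omega)
  · funext k
    rw [add_assoc]
    exact hexp _ (by omega)

theorem IsInput.isOutput_interpolationPoly (hs : IsInput H s)
    (hcount : s'.nat 2 0 = ∏ l ∈ range (m + m), radix m N l)
    (hexp : ∀ t < s'.nat 2 0, ∀ l < m + m,
      s'.nat 3 (t * (m + m) + l) = digit (radix m N) t l)
    (hcoeff : ∀ t < s'.nat 2 0, s'.num 1 t = coeffAt m N (s.num 0) t) :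
    IsOutput (interpolationPoly H) s' := by
  refine ⟨fun t ht t' ht' h => ?_, ?_⟩
  · rw [outputExponent_eq (hexp t ht), outputExponent_eq (hexp t' ht')] at h
    rw [hcount] at ht ht'
    exact injOn_digitPair N ht ht' (pairExponent_injective h)
  · rw [interpolationPoly, ← sum_digitPair N, hcount]
    refine sum_congr rfl fun t ht => ?_
    have ht' : t < s'.nat 2 0 := hcount ▸ mem_range.1 ht
    rw [outputExponent_eq (hexp t ht'), hcoeff t ht', hs.coeffAt_eq]

end RealRAM

/-! ## Polynomial time on the real RAM -/

namespace RealRAM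

open Finset

/-- `g` is bounded by a polynomial in `size`; the parameters range over all of `Γ`. -/
def PolyBounded {Γ : Type*} (size g : Γ → ℕ) : Prop :=
  ∃ P : Polynomial ℕ, ∀ γ, g γ ≤ P.eval (size γ)

namespace PolyBounded

variable {Γ Δ : Type*} {size f g : Γ → ℕ}

theorem mono (hg : PolyBounded size g) (h : ∀ γ, f γ ≤ g γ) : PolyBounded size f :=
  hg.imp fun _ hP γ => (h γ).trans (hP γ)

theorem comp (hg : PolyBounded size g) (φ : Δ → Γ) :
    PolyBounded (fun δ => size (φ δ)) fun δ => g (φ δ) :=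
  hg.imp fun _ hP δ => hP (φ δ)

theorem self (size : Γ → ℕ) : PolyBounded size size :=
  ⟨.X, fun _ => by rw [Polynomial.eval_X]⟩

theorem const (size : Γ → ℕ) (c : ℕ) : PolyBounded size fun _ => c :=
  ⟨.C c, fun _ => by rw [Polynomial.eval_C]⟩

theorem add : PolyBounded size f → PolyBounded size g → PolyBounded size fun γ => f γ + g γ :=
  fun ⟨P, hP⟩ ⟨Q, hQ⟩ => ⟨P + Q, fun γ => by
    rw [Polynomial.eval_add]
    exact add_le_add (hP γ) (hQ γ)⟩

theorem mul : PolyBounded size f → PolyBounded size g → PolyBounded size fun γ => f γ * g γ :=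
  fun ⟨P, hP⟩ ⟨Q, hQ⟩ => ⟨P * Q, fun γ => by
    rw [Polynomial.eval_mul]
    exact Nat.mul_le_mul (hP γ) (hQ γ)⟩

theorem exists_le_mul_pow (hg : PolyBounded size g) (hsize : ∀ γ, 1 ≤ size γ) :
    ∃ c, ∀ γ, g γ ≤ c * size γ ^ c := by
  obtain ⟨P, hP⟩ := hg
  refine ⟨P.eval 1 + P.natDegree, fun γ => (hP γ).trans ?_⟩
  calc P.eval (size γ) ≤ P.eval 1 * size γ ^ P.natDegree := by
        rw [P.eval_eq_sum_range, P.eval_eq_sum_range, sum_mul]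
        refine sum_le_sum fun i hi => ?_
        rw [one_pow, mul_one]
        exact Nat.mul_le_mul_left _
          (Nat.pow_le_pow_right (hsize γ) (Nat.lt_succ_iff.1 (mem_range.1 hi)))
    _ ≤ _ := Nat.mul_le_mul (Nat.le_add_right _ _)
      (Nat.pow_le_pow_right (hsize γ) (Nat.le_add_left _ _))

end PolyBounded

/-- There is a single program that takes every state `s` with `pre γ s`, whatever the parameter `γ`,
to a state `s'` with `post γ s s'`, in time polynomial in `size γ`. -/
def PolyTime {Γ : Type*} (size : Γ → ℕ) (pre : Γ → State → Prop)
    (post : Γ → State → State → Prop) : Prop :=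
  ∃ (p : Prog) (T : Γ → ℕ), PolyBounded size T ∧
    ∀ γ s, pre γ s → post γ s (p.exec s) ∧ p.time s ≤ T γ

namespace PolyTime

variable {Γ : Type*} {size : Γ → ℕ} {pre pre' : Γ → State → Prop}
  {post post' : Γ → State → State → Prop}

theorem imp (h : PolyTime size pre post)
    (himp : ∀ γ s s', pre γ s → post γ s s' → post' γ s s') : PolyTime size pre post' := by
  obtain ⟨p, T, hT, hp⟩ := h
  exact ⟨p, T, hT, fun γ s hs => ⟨himp γ s _ hs (hp γ s hs).1, (hp γ s hs).2⟩⟩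

theorem seq (h : PolyTime size pre post) (h' : PolyTime size pre' post')
    (hpre : ∀ γ s s', pre γ s → post γ s s' → pre' γ s') :
    PolyTime size pre fun γ s s'' => ∃ s', post γ s s' ∧ post' γ s' s'' := by
  obtain ⟨p, T, hT, hp⟩ := h
  obtain ⟨p', T', hT', hp'⟩ := h'
  refine ⟨.seq p p', _, hT.add hT', fun γ s hs => ?_⟩
  obtain ⟨hpost, ht⟩ := hp γ s hs
  obtain ⟨hpost', ht'⟩ := hp' γ _ (hpre γ s _ hs hpost)
  exact ⟨⟨_, hpost, hpost'⟩, add_le_add ht ht'⟩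

end PolyTime

/-! ### Contexts -/

/-- The states `s` and `s'` agree on the natural arrays in `A` and on the complex arrays in `B`. -/
structure Agree (A B : Set ℕ) (s s' : State) : Prop where
  nat : Set.EqOn s'.nat s.nat A
  num : Set.EqOn s'.num s.num B

namespace Agree

variable {A A' B B' : Set ℕ} {s s' s'' : State}

theorem refl (A B : Set ℕ) (s : State) : Agree A B s s := ⟨fun _ _ => rfl, fun _ _ => rfl⟩

theorem mono (h : Agree A B s s') (hA : A' ⊆ A) (hB : B' ⊆ B) : Agree A' B' s s' :=
  ⟨h.nat.mono hA, h.num.mono hB⟩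

theorem trans (h : Agree A B s s') (h' : Agree A B s' s'') : Agree A B s s'' :=
  ⟨h'.nat.trans h.nat, h'.num.trans h.num⟩

theorem writeNat (h : Agree A B s s') {a : ℕ} (ha : a ∉ A) (x v : ℕ) :
    Agree A B s (s'.writeNat a x v) :=
  ⟨fun _ hb => (Function.update_of_ne (ne_of_mem_of_not_mem hb ha) _ _).trans (h.nat hb), h.num⟩

theorem writeNum (h : Agree A B s s') {a : ℕ} (ha : a ∉ B) (x : ℕ) (v : ℂ) :
    Agree A B s (s'.writeNum a x v) :=
  ⟨h.nat, fun _ hb => (Function.update_of_ne (ne_of_mem_of_not_mem hb ha) _ _).trans (h.num hb)⟩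

end Agree

theorem nat_writeNat_self (s : State) (a x v : ℕ) : (s.writeNat a x v).nat a x = v := by
  simp only [State.writeNat, Function.update_self]

theorem nat_writeNat_of_index_ne (s : State) (a : ℕ) {x y : ℕ} (h : y ≠ x) (v : ℕ) :
    (s.writeNat a x v).nat a y = s.nat a y := by
  simp only [State.writeNat, Function.update_self, Function.update_of_ne h]

theorem nat_writeNat_of_ne (s : State) {a b : ℕ} (h : b ≠ a) (x v : ℕ) :
    (s.writeNat a x v).nat b = s.nat b :=
  Function.update_of_ne h _ _

theorem num_writeNum_self (s : State) (a x : ℕ) (v : ℂ) : (s.writeNum a x v).num a x = v := by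
  simp only [State.writeNum, Function.update_self]

theorem num_writeNum_of_index_ne (s : State) (a : ℕ) {x y : ℕ} (h : y ≠ x) (v : ℂ) :
    (s.writeNum a x v).num a y = s.num a y := by
  simp only [State.writeNum, Function.update_self, Function.update_of_ne h]

/-- What a program knows about its state at a given point, for each value of the parameters: the
contents `input` of complex array `0`, and the property `Holds` of the natural arrays, which does
not involve the output arrays `2` and `3` nor the arrays from `free` on. -/
structure Context (Γ : Type*) where
  size : Γ → ℕ
  input : Γ → ℕ → ℂ
  free : ℕ
  Holds : Γ → (ℕ → ℕ → ℕ) → Prop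
  four_le_free : 4 ≤ free
  holds_congr : ∀ {γ f g}, Set.EqOn g f (Set.Iio free \ {2, 3}) → Holds γ f → Holds γ g

namespace Context

variable {Γ : Type*} {C : Context Γ} {γ : Γ} {s s' : State}

/-- The state `s` is as the context `C` says for the parameter `γ`. -/
def Represents (C : Context Γ) (γ : Γ) (s : State) : Prop :=
  s.num 0 = C.input γ ∧ C.Holds γ s.nat

theorem Represents.congr (hs : C.Represents γ s) (h : Agree (Set.Iio C.free \ {2, 3}) {0} s s') :
    C.Represents γ s' :=
  ⟨(h.num rfl).trans hs.1, C.holds_congr h.nat hs.2⟩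

theorem free_notMem (C : Context Γ) : C.free ∉ ({2, 3} : Set ℕ) := by
  have := C.four_le_free
  simp only [Set.mem_insert_iff, Set.mem_singleton_iff]
  omega

/-- The context `C` with the parameters replaced by their values at `φ`. -/
def pull {Δ : Type*} (C : Context Γ) (φ : Δ → Γ) : Context Δ where
  size δ := C.size (φ δ)
  input δ := C.input (φ δ)
  free := C.free
  Holds δ := C.Holds (φ δ)
  four_le_free := C.four_le_free
  holds_congr := C.holds_congr

/-- The context in which, moreover, the array `free` has the property `Q`. -/
def extend (C : Context Γ) (Q : Γ → (ℕ → ℕ) → Prop) : Context Γ where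
  size := C.size
  input := C.input
  free := C.free + 1
  Holds γ f := C.Holds γ f ∧ Q γ (f C.free)
  four_le_free := C.four_le_free.trans (Nat.le_succ _)
  holds_congr {_ _ _} h hf := by
    refine ⟨C.holds_congr (h.mono (Set.sdiff_subset_sdiff_left (Set.Iio_subset_Iio
      (Nat.le_succ _)))) hf.1, ?_⟩
    rw [h ⟨Nat.lt_succ_self _, C.free_notMem⟩]
    exact hf.2

/-- The context in the body of a loop of `b γ` rounds, whose variable is in array `free`; the round
becomes a parameter. -/
def push (C : Context Γ) (b : Γ → ℕ) : Context ((γ : Γ) × Fin (b γ)) :=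
  (C.pull Sigma.fst).extend fun x A => A 0 = x.2

theorem Represents.push {b : Γ → ℕ} (hs : C.Represents γ s) (i : Fin (b γ)) :
    (C.push b).Represents ⟨γ, i⟩ (s.writeNat C.free 0 i) :=
  have h : C.Represents γ (s.writeNat C.free 0 i) := hs.congr
    ((Agree.refl _ _ s).writeNat (fun h => lt_irrefl _ (Set.mem_Iio.1 h.1)) 0 i)
  And.intro h.1 ⟨h.2, nat_writeNat_self _ _ _ _⟩

end Context

/-! ### Integer expressions -/

/-- `g` is given by an integer expression that is evaluated in polynomial time. -/
structure IsIndex {Γ : Type*} (C : Context Γ) (g : Γ → ℕ) : Prop where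
  polyBounded : PolyBounded C.size g
  exists_expr : ∃ (e : NatExpr) (T : Γ → ℕ), PolyBounded C.size T ∧
    ∀ γ s, C.Represents γ s → e.eval s = g γ ∧ e.cost s ≤ T γ

theorem size_le_self (n : ℕ) : n.size ≤ n := Nat.size_le.2 Nat.lt_two_pow_self

namespace IsIndex

variable {Γ : Type*} {C : Context Γ} {f g b : Γ → ℕ}

theorem lit (n : ℕ) : IsIndex C fun _ => n :=
  ⟨.const _ n, .lit n, _, .const _ (1 + n.size), fun _ _ _ => ⟨rfl, le_rfl⟩⟩

theorem binary (op : NatExpr → NatExpr → NatExpr) (φ : ℕ → ℕ → ℕ)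
    (heval : ∀ a b s, (op a b).eval s = φ (a.eval s) (b.eval s))
    (hcost : ∀ a b s, (op a b).cost s =
      a.cost s + b.cost s + 1 + (φ (a.eval s) (b.eval s)).size)
    (hφ : PolyBounded C.size fun γ => φ (f γ) (g γ)) (hf : IsIndex C f) (hg : IsIndex C g) :
    IsIndex C fun γ => φ (f γ) (g γ) := by
  obtain ⟨e, T, hT, he⟩ := hf.exists_expr
  obtain ⟨e', T', hT', he'⟩ := hg.exists_expr
  refine ⟨hφ, op e e', _, ((hT.add hT').add (.const _ 1)).add hφ, fun γ s hs => ?_⟩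
  obtain ⟨hval, ht⟩ := he γ s hs
  obtain ⟨hval', ht'⟩ := he' γ s hs
  rw [heval, hcost, hval, hval']
  exact ⟨rfl, by gcongr; exact size_le_self _⟩

theorem add (hf : IsIndex C f) (hg : IsIndex C g) : IsIndex C fun γ => f γ + g γ :=
  binary .add (· + ·) (fun _ _ _ => rfl) (fun _ _ _ => rfl) (hf.polyBounded.add hg.polyBounded)
    hf hg

theorem mul (hf : IsIndex C f) (hg : IsIndex C g) : IsIndex C fun γ => f γ * g γ :=
  binary .mul (· * ·) (fun _ _ _ => rfl) (fun _ _ _ => rfl) (hf.polyBounded.mul hg.polyBounded)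
    hf hg

theorem sub (hf : IsIndex C f) (hg : IsIndex C g) : IsIndex C fun γ => f γ - g γ :=
  binary .sub (· - ·) (fun _ _ _ => rfl) (fun _ _ _ => rfl)
    (hf.polyBounded.mono fun _ => Nat.sub_le _ _) hf hg

theorem div (hf : IsIndex C f) (hg : IsIndex C g) : IsIndex C fun γ => f γ / g γ :=
  binary .div (· / ·) (fun _ _ _ => rfl) (fun _ _ _ => rfl)
    (hf.polyBounded.mono fun _ => Nat.div_le_self _ _) hf hg

theorem mod (hf : IsIndex C f) (hg : IsIndex C g) : IsIndex C fun γ => f γ % g γ :=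
  binary .mod (· % ·) (fun _ _ _ => rfl) (fun _ _ _ => rfl)
    (hf.polyBounded.mono fun _ => Nat.mod_le _ _) hf hg

theorem min (hf : IsIndex C f) (hg : IsIndex C g) : IsIndex C fun γ => Min.min (f γ) (g γ) := by
  simpa only [tsub_tsub_eq_min] using hf.sub (hf.sub hg)

theorem max (hf : IsIndex C f) (hg : IsIndex C g) : IsIndex C fun γ => Max.max (f γ) (g γ) := by
  simpa only [add_tsub_eq_max] using hf.add (hg.sub hf)

theorem load (a : ℕ) (hg : IsIndex C g) (hf : PolyBounded C.size f)
    (h : ∀ γ s, C.Represents γ s → s.nat a (g γ) = f γ) : IsIndex C f := by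
  obtain ⟨e, T, hT, he⟩ := hg.exists_expr
  refine ⟨hf, .load a e, _, (hT.add (.const _ 1)).add hf, fun γ s hs => ?_⟩
  obtain ⟨hval, ht⟩ := he γ s hs
  rw [NatExpr.eval, NatExpr.cost, hval, h γ s hs]
  exact ⟨rfl, by gcongr; exact size_le_self _⟩

theorem pull {Δ : Type*} (hg : IsIndex C g) (φ : Δ → Γ) :
    IsIndex (C.pull φ) fun δ => g (φ δ) := by
  obtain ⟨e, T, hT, he⟩ := hg.exists_expr
  exact ⟨hg.polyBounded.comp φ, e, _, hT.comp φ, fun δ => he (φ δ)⟩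

theorem extend (hg : IsIndex C g) (Q : Γ → (ℕ → ℕ) → Prop) : IsIndex (C.extend Q) g := by
  obtain ⟨e, T, hT, he⟩ := hg.exists_expr
  exact ⟨hg.polyBounded, e, T, hT, fun γ s hs => he γ s ⟨hs.1, hs.2.1⟩⟩

theorem weaken (hg : IsIndex C g) : IsIndex (C.push b) fun x => g x.1 :=
  (hg.pull Sigma.fst).extend _

theorem var (hb : IsIndex C b) : IsIndex (C.push b) fun x => x.2 :=
  load C.free (lit 0) ((hb.polyBounded.comp Sigma.fst).mono fun x => x.2.2.le)
    fun _ _ hs => hs.2.2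

end IsIndex

/-! ### Programs -/

namespace PolyTime

variable {Γ : Type*} {C : Context Γ} {f g b : Γ → ℕ}

theorem setNat (a : ℕ) (hg : IsIndex C g) (hf : IsIndex C f) :
    PolyTime C.size C.Represents fun γ s s' => s' = s.writeNat a (g γ) (f γ) := by
  obtain ⟨e, T, hT, he⟩ := hg.exists_expr
  obtain ⟨e', T', hT', he'⟩ := hf.exists_expr
  refine ⟨.setNat a e e', _, (hT.add hT').add (.const _ 1), fun γ s hs => ?_⟩
  obtain ⟨hval, ht⟩ := he γ s hs
  obtain ⟨hval', ht'⟩ := he' γ s hs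
  rw [Prog.exec, Prog.time, hval, hval']
  exact ⟨rfl, by gcongr⟩

theorem setNum (a : ℕ) (hg : IsIndex C g) (e : NumExpr) {T : Γ → ℕ} (hT : PolyBounded C.size T)
    (he : ∀ γ s, C.Represents γ s → e.cost s ≤ T γ) :
    PolyTime C.size C.Represents fun γ s s' => s' = s.writeNum a (g γ) (e.eval s) := by
  obtain ⟨e', T', hT', he'⟩ := hg.exists_expr
  refine ⟨.setNum a e' e, _, (hT'.add hT).add (.const _ 1), fun γ s hs => ?_⟩
  obtain ⟨hval, ht⟩ := he' γ s hs
  have ht' := he γ s hs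
  rw [Prog.exec, Prog.time, hval]
  exact ⟨rfl, by gcongr⟩

/-- The rule for loops; `Inv γ s i` holds of the state after `i` rounds from `s`. -/
theorem forLoop (hb : IsIndex C b) {pre : Γ → State → Prop}
    (hpre : ∀ γ s, pre γ s → C.Represents γ s) {pre' : (γ : Γ) × Fin (b γ) → State → Prop}
    {post : (γ : Γ) × Fin (b γ) → State → State → Prop}
    (hbody : PolyTime (fun x => C.size x.1) pre' post) (Inv : Γ → State → ℕ → State → Prop)
    (hzero : ∀ γ s, pre γ s → Inv γ s 0 s)
    (hinv : ∀ γ s (i : Fin (b γ)) σ, pre γ s → Inv γ s i σ →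
      pre' ⟨γ, i⟩ (σ.writeNat C.free 0 i))
    (hsucc : ∀ γ s (i : Fin (b γ)) σ σ', pre γ s → Inv γ s i σ →
      post ⟨γ, i⟩ (σ.writeNat C.free 0 i) σ' → Inv γ s (i + 1) σ') :
    PolyTime C.size pre fun γ s s' => Inv γ s (b γ) s' := by
  obtain ⟨e, T, hT, he⟩ := hb.exists_expr
  obtain ⟨p, T', ⟨P, hP⟩, hp⟩ := hbody
  have hiter : ∀ γ s, pre γ s → ∀ i ≤ b γ, Inv γ s i (iterate C.free p.exec s i) := by
    intro γ s hs i
    induction i with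
    | zero => exact fun _ => hzero γ s hs
    | succ i ih =>
      intro hi
      have h := ih (by omega)
      exact hsucc γ s ⟨i, hi⟩ _ _ hs h (hp _ _ (hinv γ s ⟨i, hi⟩ _ hs h)).1
  refine ⟨.forLoop C.free e p, fun γ => T γ + 1 + b γ * (1 + b γ + P.eval (C.size γ)),
    (hT.add (.const _ 1)).add (hb.polyBounded.mul
      (((PolyBounded.const _ 1).add hb.polyBounded).add ⟨P, fun _ => le_rfl⟩)), fun γ s hs => ?_⟩
  obtain ⟨hval, ht⟩ := he γ s (hpre γ s hs)
  rw [Prog.exec, Prog.time, hval]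
  refine ⟨hiter γ s hs _ le_rfl, Nat.add_le_add (Nat.add_le_add_right ht 1) ?_⟩
  refine (sum_le_card_nsmul _ _ (1 + b γ + P.eval (C.size γ)) fun i hi => ?_).trans ?_
  · have hi := mem_range.1 hi
    have hbody := (hp ⟨γ, i, hi⟩ _ (hinv γ s ⟨i, hi⟩ _ hs (hiter γ s hs i hi.le))).2
    have := size_le_self i
    have hP : T' ⟨γ, i, hi⟩ ≤ P.eval (C.size γ) := hP ⟨γ, i, hi⟩
    exact Nat.add_le_add (by omega) (hbody.trans hP)
  · rw [card_range, smul_eq_mul]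

end PolyTime

end RealRAM

/-! ### Complex expressions -/

namespace RealRAM

open Finset Complex

/-- The expressions formed with `op` stand for the operation `φ`, which has unit cost. -/
structure UnitCost (op : NumExpr → NumExpr → NumExpr) (φ : ℂ → ℂ → ℂ) : Prop where
  eval : ∀ a b s, (op a b).eval s = φ (a.eval s) (b.eval s)
  cost : ∀ a b s, (op a b).cost s = a.cost s + b.cost s + 1

namespace UnitCost

theorem add : UnitCost .add (· + ·) := ⟨fun _ _ _ => rfl, fun _ _ _ => rfl⟩

theorem sub : UnitCost .sub (· - ·) := ⟨fun _ _ _ => rfl, fun _ _ _ => rfl⟩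

theorem mul : UnitCost .mul (· * ·) := ⟨fun _ _ _ => rfl, fun _ _ _ => rfl⟩

theorem div : UnitCost .div (· / ·) := ⟨fun _ _ _ => rfl, fun _ _ _ => rfl⟩

end UnitCost

/-- `z` is the value of a complex expression that does not read the state. -/
def IsConst (z : ℂ) : Prop := ∃ (e : NumExpr) (c : ℕ), ∀ s, e.eval s = z ∧ e.cost s ≤ c

namespace IsConst

variable {op : NumExpr → NumExpr → NumExpr} {φ : ℂ → ℂ → ℂ} {z w : ℂ}

theorem binary (hop : UnitCost op φ) (hz : IsConst z)
    (hw : IsConst w) : IsConst (φ z w) := by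
  obtain ⟨e, c, he⟩ := hz
  obtain ⟨e', c', he'⟩ := hw
  refine ⟨op e e', c + c' + 1, fun s => ?_⟩
  rw [hop.eval, hop.cost, (he s).1, (he' s).1]
  exact ⟨rfl, by gcongr; exacts [(he s).2, (he' s).2]⟩

theorem natCast (n : ℕ) : IsConst n :=
  ⟨.ofNat (.lit n), 1 + n.size + 1, fun _ => ⟨rfl, le_rfl⟩⟩

theorem one : IsConst 1 := by simpa only [Nat.cast_one] using natCast 1

theorem I : IsConst I := ⟨.imagUnit, 1, fun _ => ⟨rfl, le_rfl⟩⟩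

theorem mul (hz : IsConst z) (hw : IsConst w) : IsConst (z * w) :=
  binary .mul hz hw

theorem div (hz : IsConst z) (hw : IsConst w) : IsConst (z / w) :=
  binary .div hz hw

theorem neg (hz : IsConst z) : IsConst (-z) := by
  have h := binary .sub (natCast 0) hz
  rwa [Nat.cast_zero, zero_sub] at h

theorem sqrt {x : ℝ} (hx : IsConst x) : IsConst (√x : ℝ) := by
  obtain ⟨e, c, he⟩ := hx
  refine ⟨.sqrt e, c + 1, fun s => ⟨?_, Nat.add_le_add_right (he s).2 1⟩⟩
  rw [NumExpr.eval, (he s).1, ofReal_re]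

end IsConst

theorem prod_range_odd (n : ℕ) : ∏ i ∈ range n, (2 * i + 1) = (2 * n - 1).doubleFactorial := by
  induction n with
  | zero => rfl
  | succ n ih =>
    rw [prod_range_succ, ih, mul_comm]
    exact (Nat.doubleFactorial_add_one (2 * n)).symm

/-- A single program computes `f γ` into the register `r`, which is cell `0` of complex array
`r + 2`, in polynomial time. It may also use the registers after `r` and the natural arrays that are
free in `C`. -/
def Computes {Γ : Type*} (C : Context Γ) (r : ℕ) (f : Γ → ℂ) : Prop :=
  PolyTime C.size C.Represents fun γ s s' =>
    s'.num (r + 2) 0 = f γ ∧ Agree (Set.Iio C.free) (Set.Iio (r + 2)) s s'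

namespace Computes

variable {Γ : Type*} {C : Context Γ} {r : ℕ} {f g : Γ → ℂ} {op : NumExpr → NumExpr → NumExpr}
  {φ : ℂ → ℂ → ℂ} {b n k : Γ → ℕ}

theorem of_expr (e : NumExpr) {T : Γ → ℕ} (hT : PolyBounded C.size T)
    (he : ∀ γ s, C.Represents γ s → e.eval s = f γ ∧ e.cost s ≤ T γ) : Computes C r f := by
  refine (PolyTime.setNum (r + 2) (.lit 0) e hT fun γ s hs => (he γ s hs).2).imp ?_
  rintro γ s _ hs rfl
  exact ⟨(num_writeNum_self _ _ _ _).trans (he γ s hs).1,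
    (Agree.refl _ (Set.Iio (r + 2)) s).writeNum Set.self_notMem_Iio _ _⟩

theorem const {z : ℂ} (hz : IsConst z) : Computes C r fun _ => z := by
  obtain ⟨e, c, he⟩ := hz
  exact of_expr e (.const _ c) fun _ s _ => he s

theorem natCast (hn : IsIndex C n) : Computes C r fun γ => (n γ : ℂ) := by
  obtain ⟨e, T, hT, he⟩ := hn.exists_expr
  refine of_expr (.ofNat e) (hT.add (.const _ 1)) fun γ s hs => ?_
  rw [NumExpr.eval, NumExpr.cost, (he γ s hs).1]
  exact ⟨rfl, Nat.add_le_add_right (he γ s hs).2 1⟩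

theorem input (hn : IsIndex C n) : Computes C r fun γ => C.input γ (n γ) := by
  obtain ⟨e, T, hT, he⟩ := hn.exists_expr
  refine of_expr (.load 0 e) (hT.add (.const _ 1)) fun γ s hs => ?_
  rw [NumExpr.eval, NumExpr.cost, (he γ s hs).1, hs.1]
  exact ⟨rfl, Nat.add_le_add_right (he γ s hs).2 1⟩

theorem represents {γ : Γ} {s s' : State} (hs : C.Represents γ s)
    (h : Agree (Set.Iio C.free) (Set.Iio (r + 2)) s s') : C.Represents γ s' :=
  hs.congr (h.mono Set.sdiff_subset (Set.singleton_subset_iff.2 (Nat.succ_pos _)))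

theorem accumulate (hop : UnitCost op φ) (hg : Computes C (r + 1) g) :
    PolyTime C.size C.Represents fun γ s s' => s'.num (r + 2) 0 = φ (s.num (r + 2) 0) (g γ) ∧
      Agree (Set.Iio C.free) (Set.Iio (r + 2)) s s' := by
  have hset := PolyTime.setNum (r + 2) (.lit (C := C) 0)
    (op (.load (r + 2) (.lit 0)) (.load (r + 3) (.lit 0))) (.const _ 5) fun _ s _ => by
      rw [hop.cost]
      exact le_rfl
  refine (hg.seq hset fun γ s s' hs h => represents hs h.2).imp ?_
  rintro γ s _ - ⟨s', ⟨hval, hag⟩, rfl⟩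
  refine ⟨?_, (hag.mono le_rfl (Set.Iio_subset_Iio (Nat.le_succ _))).writeNum
    Set.self_notMem_Iio _ _⟩
  rw [num_writeNum_self, hop.eval]
  exact congrArg₂ φ (congrFun (hag.num (Nat.lt_succ_self _)) 0) hval

theorem binary (hop : UnitCost op φ) (hf : Computes C r f)
    (hg : Computes C (r + 1) g) : Computes C r fun γ => φ (f γ) (g γ) := by
  refine (hf.seq (accumulate hop hg) fun γ s s' hs h => represents hs h.2).imp ?_
  rintro γ s s'' - ⟨s', ⟨hval, hag⟩, hval', hag'⟩
  exact ⟨by rw [hval', hval], hag.trans hag'⟩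

theorem mul (hf : Computes C r f) (hg : Computes C (r + 1) g) : Computes C r fun γ => f γ * g γ :=
  binary .mul hf hg

theorem div (hf : Computes C r f) (hg : Computes C (r + 1) g) : Computes C r fun γ => f γ / g γ :=
  binary .div hf hg

theorem sqrt {x : Γ → ℝ} (hx : Computes C r fun γ => (x γ : ℂ)) :
    Computes C r fun γ => (√(x γ) : ℝ) := by
  have hset := PolyTime.setNum (r + 2) (.lit (C := C) 0) (.sqrt (.load (r + 2) (.lit 0)))
    (.const _ 3) fun _ _ _ => le_rfl
  refine (hx.seq hset fun γ s s' hs h => represents hs h.2).imp ?_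
  rintro γ s _ - ⟨s', ⟨hval, hag⟩, rfl⟩
  refine ⟨?_, hag.writeNum Set.self_notMem_Iio _ _⟩
  rw [num_writeNum_self]
  exact congrArg (fun z : ℂ => ((√z.re : ℝ) : ℂ)) hval

theorem fold (hop : UnitCost op φ) {z : ℂ} (hz : IsConst z)
    (hb : IsIndex C b) {F : Γ → ℕ → ℂ} (hF : Computes (C.push b) (r + 1) fun x => F x.1 x.2)
    {G : Γ → ℕ → ℂ} (hG : ∀ γ, G γ 0 = z) (hG' : ∀ γ i, G γ (i + 1) = φ (G γ i) (F γ i)) :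
    Computes C r fun γ => G γ (b γ) := by
  have hloop := PolyTime.forLoop hb
    (pre := fun γ s => C.Represents γ s ∧ s.num (r + 2) 0 = z) (fun _ _ hs => hs.1)
    (accumulate hop hF)
    (fun γ s i σ => σ.num (r + 2) 0 = G γ i ∧ Agree (Set.Iio C.free) (Set.Iio (r + 2)) s σ)
    (fun γ s hs => ⟨hs.2.trans (hG γ).symm, .refl _ _ s⟩)
    (fun γ s i σ hs h => (represents hs.1 h.2).push i) (fun γ s i σ σ' _ h h' => by
      refine ⟨h'.1.trans ((congrArg₂ φ h.1 rfl).trans (hG' γ i).symm), ?_⟩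
      exact (h.2.writeNat Set.self_notMem_Iio 0 i).trans
        (h'.2.mono (Set.Iio_subset_Iio (Nat.le_succ _)) le_rfl))
  refine ((const hz).seq hloop fun γ s s' hs h => ⟨represents hs h.2, h.1⟩).imp ?_
  rintro γ s s'' - ⟨s', ⟨-, hag⟩, hval, hag'⟩
  exact ⟨hval, hag.trans hag'⟩

theorem sum (hb : IsIndex C b) {F : Γ → ℕ → ℂ}
    (hF : Computes (C.push b) (r + 1) fun x => F x.1 x.2) :
    Computes C r fun γ => ∑ i ∈ range (b γ), F γ i :=
  fold .add (.natCast 0) hb hF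
    (G := fun γ i => ∑ j ∈ range i, F γ j) (fun _ => by rw [sum_range_zero, Nat.cast_zero])
    fun _ _ => sum_range_succ _ _

theorem prod (hb : IsIndex C b) {F : Γ → ℕ → ℂ}
    (hF : Computes (C.push b) (r + 1) fun x => F x.1 x.2) :
    Computes C r fun γ => ∏ i ∈ range (b γ), F γ i :=
  fold .mul .one hb hF
    (G := fun γ i => ∏ j ∈ range i, F γ j) (fun _ => prod_range_zero _)
    fun _ _ => prod_range_succ _ _

theorem pow {z : ℂ} (hz : IsConst z) (hn : IsIndex C n) : Computes C r fun γ => z ^ n γ := by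
  simpa only [prod_const, card_range] using prod (r := r) hn (F := fun _ _ => z) (const hz)

theorem descFactorial (hn : IsIndex C n) (hk : IsIndex C k) :
    Computes C r fun γ => ((n γ).descFactorial (k γ) : ℂ) := by
  simp only [Nat.descFactorial_eq_prod_range, Nat.cast_prod]
  exact prod hk (F := fun γ i => ((n γ - i : ℕ) : ℂ)) (natCast (hn.weaken.sub (.var hk)))

theorem factorial (hn : IsIndex C n) : Computes C r fun γ => ((n γ).factorial : ℂ) := by
  simpa only [Nat.descFactorial_self] using descFactorial hn hn

theorem choose (hn : IsIndex C n) (hk : IsIndex C k) :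
    Computes C r fun γ => ((n γ).choose (k γ) : ℂ) := by
  have hdiv (γ) : ((n γ).choose (k γ) : ℂ) =
      (n γ).descFactorial (k γ) / (k γ).factorial := by
    rw [eq_div_iff (Nat.cast_ne_zero.2 (k γ).factorial_ne_zero), mul_comm,
      Nat.descFactorial_eq_factorial_mul_choose, Nat.cast_mul]
  simp only [hdiv]
  exact (descFactorial hn hk).div (factorial hk)

theorem doubleFactorial_odd (hn : IsIndex C n) :
    Computes C r fun γ => ((2 * n γ - 1).doubleFactorial : ℂ) := by
  simp only [← prod_range_odd, Nat.cast_prod]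
  exact prod hn (F := fun _ i => ((2 * i + 1 : ℕ) : ℂ))
    (natCast (((IsIndex.lit 2).mul (.var hn)).add (.lit 1)))

theorem indicator (hn : IsIndex C n) (hk : IsIndex C k) :
    Computes C r fun γ => if n γ = k γ then 1 else 0 := by
  have hsub (γ) : (if n γ = k γ then 1 else 0 : ℂ) =
      ((1 - (n γ - k γ + (k γ - n γ)) : ℕ) : ℂ) := by
    split_ifs with h
    · rw [h, Nat.sub_self, Nat.cast_one]
    · rw [show 1 - (n γ - k γ + (k γ - n γ)) = 0 by omega, Nat.cast_zero]
  simp only [hsub]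
  exact natCast ((IsIndex.lit 1).sub ((hn.sub hk).add (hk.sub hn)))

end Computes

end RealRAM

namespace RealRAM.Computes

open Finset Complex

variable {Γ : Type*} {C : Context Γ} {r : ℕ} {z l l' : ℂ} {N u v a b b' c c' d i j α β : Γ → ℕ}

theorem swapCoeff (hz : IsConst z) (hb : IsIndex C b) (ha : IsIndex C a) (hc : IsIndex C c) :
    Computes C r fun γ => _root_.swapCoeff z (b γ) (a γ) (c γ) :=
  ((pow hz hc).mul (choose hb hc)).mul (descFactorial ha hc)

theorem powCoeff (hz : IsConst z) (hl : IsConst l) (hu : IsIndex C u) (hb : IsIndex C b)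
    (hc : IsIndex C c) : Computes C r fun γ => _root_.powCoeff z l (u γ) (b γ) (c γ) :=
  have h2 := (IsIndex.lit 2).mul hc
  ((((pow (hl.mul hz) hc).mul (pow hl hb)).mul (choose hu h2)).mul (doubleFactorial_odd hc)).mul
    (choose (hu.sub h2) hb)

theorem newtonCoeff (hi : IsIndex C i) (hj : IsIndex C j) :
    Computes C r fun γ => _root_.newtonCoeff ℂ (i γ) (j γ) :=
  ((pow (.neg .one) (hj.add hi)).mul (choose hj hi)).div (factorial hj)

theorem powMulPowCoeff_summand (hz : IsConst z) (hl : IsConst l) (hl' : IsConst l')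
    (hu : IsIndex C u) (hv : IsIndex C v) (hα : IsIndex C α) (hβ : IsIndex C β) (hb : IsIndex C b)
    (hb' : IsIndex C b') (hc : IsIndex C c) (hc' : IsIndex C c') (hd : IsIndex C d) :
    Computes C r fun γ => _root_.powCoeff z l (u γ) (b γ) (c γ) *
      _root_.powCoeff z l' (v γ) (b' γ) (c' γ) *
      _root_.swapCoeff z (b γ) (v γ - 2 * c' γ - b' γ) (d γ) *
        ((if α γ = u γ - 2 * c γ - b γ + (v γ - 2 * c' γ - b' γ - d γ) then 1 else 0) *
          if β γ = b γ - d γ + b' γ then 1 else 0) := by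
  have hn := (hu.sub ((IsIndex.lit 2).mul hc)).sub hb
  have hn' := (hv.sub ((IsIndex.lit 2).mul hc')).sub hb'
  exact (((powCoeff hz hl hu hb hc).mul (powCoeff hz hl' hv hb' hc')).mul
    (swapCoeff hz hb hn' hd)).mul
    ((indicator hα (hn.add (hn'.sub hd))).mul (indicator hβ ((hb.sub hd).add hb')))

theorem powMulPowCoeff (hz : IsConst z) (hl : IsConst l) (hl' : IsConst l') (hu : IsIndex C u)
    (hv : IsIndex C v) (hα : IsIndex C α) (hβ : IsIndex C β) :
    Computes C r fun γ => _root_.powMulPowCoeff z l l' (u γ) (v γ) (α γ) (β γ) := by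
  have hu₁ := hu.add (.lit 1)
  have hv₁ := hv.add (.lit 1)
  refine sum hu₁ (sum hv₁.weaken (sum hu₁.weaken.weaken (sum hv₁.weaken.weaken.weaken
    (sum ((IsIndex.var hu₁).add (.lit 1)).weaken.weaken.weaken ?_))))
  exact powMulPowCoeff_summand hz hl hl' hu.weaken.weaken.weaken.weaken.weaken
    hv.weaken.weaken.weaken.weaken.weaken hα.weaken.weaken.weaken.weaken.weaken
    hβ.weaken.weaken.weaken.weaken.weaken (IsIndex.var hu₁).weaken.weaken.weaken.weaken
    (IsIndex.var hv₁.weaken).weaken.weaken.weaken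
    (IsIndex.var hu₁.weaken.weaken).weaken.weaken
    (IsIndex.var hv₁.weaken.weaken.weaken).weaken
    (.var ((IsIndex.var hu₁).add (.lit 1)).weaken.weaken.weaken)

theorem ladderCoeff (hu : IsIndex C u) (hv : IsIndex C v) (hα : IsIndex C α) (hβ : IsIndex C β) :
    Computes C r fun γ => _root_.ladderCoeff (u γ) (v γ) (α γ) (β γ) :=
  (pow (IsConst.one.div (.sqrt (.natCast 2))) (hu.add hv)).mul
    (powMulPowCoeff (.neg .I) (.neg .I) .I hu hv hα hβ)

theorem modeCoeff (hN : IsIndex C N) (hi : IsIndex C i) (hj : IsIndex C j) (hα : IsIndex C α)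
    (hβ : IsIndex C β) : Computes C r fun γ => _root_.modeCoeff (N γ) (i γ) (j γ) (α γ) (β γ) := by
  have hN₁ := hN.add (.lit 1)
  have hmin := hi.min hj
  have hmax := hi.max hj
  refine .mul (sqrt ?_) (sum hN₁ (.mul (newtonCoeff hmin.weaken (.var hN₁)) (ladderCoeff
    ((hmax.sub hj).weaken.add (.var hN₁)) ((hmax.sub hi).weaken.add (.var hN₁)) hα.weaken
    hβ.weaken)))
  push_cast
  exact (factorial hmin).div (factorial hmax)

end RealRAM.Computes

/-! ### The program -/

namespace RealRAM

open Finset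

/-- In the context `C`, the values `F γ k` with `k < n γ` are stored in some array and are
polynomially bounded. -/
structure Tabulates {Γ : Type*} (C : Context Γ) (n : Γ → ℕ) (F : Γ → ℕ → ℕ) : Prop where
  exists_array : ∃ a, ∀ γ s, C.Represents γ s → ∀ k < n γ, s.nat a k = F γ k
  exists_bound : ∃ B, PolyBounded C.size B ∧ ∀ γ, ∀ k < n γ, F γ k ≤ B γ

section Tables

variable {Γ : Type*} {C : Context Γ} {n b g : Γ → ℕ} {F R : Γ → ℕ → ℕ}

namespace Tabulates

theorem pull {Δ : Type*} (hF : Tabulates C n F) (φ : Δ → Γ) :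
    Tabulates (C.pull φ) (fun δ => n (φ δ)) fun δ => F (φ δ) :=
  ⟨hF.exists_array.imp fun _ ha δ => ha (φ δ),
    let ⟨_, hB, hle⟩ := hF.exists_bound; ⟨_, hB.comp φ, fun δ => hle (φ δ)⟩⟩

theorem extend (hF : Tabulates C n F) (Q : Γ → (ℕ → ℕ) → Prop) : Tabulates (C.extend Q) n F :=
  ⟨hF.exists_array.imp fun _ ha γ s hs => ha γ s ⟨hs.1, hs.2.1⟩, hF.exists_bound⟩

theorem weaken (hF : Tabulates C n F) : Tabulates (C.push b) (fun x => n x.1) fun x => F x.1 :=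
  (hF.pull Sigma.fst).extend _

theorem isIndex (hF : Tabulates C n F) (hg : IsIndex C g) (h : ∀ γ, g γ < n γ) :
    IsIndex C fun γ => F γ (g γ) := by
  obtain ⟨a, ha⟩ := hF.exists_array
  obtain ⟨B, hB, hle⟩ := hF.exists_bound
  exact hg.load a (hB.mono fun γ => hle γ _ (h γ)) fun γ s hs => ha γ s hs _ (h γ)

end Tabulates

/-- The context in which the products of the first `k ≤ b γ` radices `R γ l` have been tabulated.
The table is in array `C.free + 1`, and `C.free` is the variable of the loop that fills it. -/
def Context.prodTable (C : Context Γ) (b : Γ → ℕ) (R : Γ → ℕ → ℕ) : Context Γ :=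
  (C.extend fun _ _ => True).extend fun γ A => ∀ k ≤ b γ, A k = ∏ l ∈ range k, R γ l

theorem prod_range_le (hR : ∀ γ l, 0 < R γ l) (γ : Γ) {k : ℕ} (hk : k ≤ b γ) :
    ∏ l ∈ range k, R γ l ≤ ∏ l ∈ range (b γ), R γ l :=
  prod_le_prod_of_subset_of_one_le' (range_subset_range.2 hk) fun l _ _ => hR γ l

theorem tabulates_prodTable (hR : ∀ γ l, 0 < R γ l)
    (hprod : PolyBounded C.size fun γ => ∏ l ∈ range (b γ), R γ l) :
    Tabulates (C.prodTable b R) (fun γ => b γ + 1) fun γ k => ∏ l ∈ range k, R γ l :=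
  ⟨⟨C.free + 1, fun _ _ hs k hk => hs.2.2 k (Nat.lt_succ_iff.1 hk)⟩,
    ⟨_, hprod, fun γ _ hk => prod_range_le hR γ (Nat.lt_succ_iff.1 hk)⟩⟩

theorem Tabulates.prodTable (hF : Tabulates C n F) : Tabulates (C.prodTable b R) n F :=
  (hF.extend _).extend _

theorem IsIndex.prodTable (hg : IsIndex C g) : IsIndex (C.prodTable b R) g :=
  (hg.extend _).extend _

theorem IsIndex.digit {t k : Γ → ℕ}
    (hprod : Tabulates C n fun γ k => ∏ l ∈ range k, R γ l) (ht : IsIndex C t) (hk : IsIndex C k)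
    (hkn : ∀ γ, k γ < n γ) (hR : IsIndex C fun γ => R γ (k γ)) :
    IsIndex C fun γ => digit (R γ) (t γ) (k γ) :=
  (ht.div (hprod.isIndex hk hkn)).mod hR

theorem Context.Represents.congr_of_agree {γ : Γ} {s s' : State} (hs : C.Represents γ s)
    (h : Agree (Set.Iio C.free) Set.univ s s') : C.Represents γ s' :=
  hs.congr (h.mono Set.sdiff_subset (Set.subset_univ _))

theorem IsIndex.radix {m k : Γ → ℕ} {N : Γ → ℕ → ℕ} (hm : IsIndex C m) (hN : Tabulates C m N)
    (hk : IsIndex C k) (hkm : ∀ γ, k γ < m γ + m γ) :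
    IsIndex C fun γ => radix (m γ) (N γ) (k γ) :=
  ((lit 3).mul (hN.isIndex (hk.mod hm)
    fun γ => Nat.mod_lt _ (by have := hkm γ; omega))).add (lit 1)

theorem PolyTime.prodTable_succ (hb : IsIndex C b) (hR : ∀ γ l, 0 < R γ l)
    (hRb : IsIndex (C.push b) fun x => R x.1 x.2)
    (hprod : PolyBounded C.size fun γ => ∏ l ∈ range (b γ), R γ l) :
    PolyTime (fun x => C.size x.1)
      (fun x s => (C.push b).Represents x s ∧ s.nat (C.free + 1) x.2 = ∏ l ∈ range x.2, R x.1 l)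
      fun x s s' => s' = s.writeNat (C.free + 1) (x.2 + 1) (∏ l ∈ range (x.2 + 1), R x.1 l) := by
  let D := (C.push b).extend fun x A => A x.2 = ∏ l ∈ range x.2, R x.1 l
  have hvar : IsIndex D fun x => (x.2 : ℕ) := (IsIndex.var hb).extend _
  have hcell : IsIndex D fun x => ∏ l ∈ range (x.2 : ℕ), R x.1 l :=
    hvar.load (C.free + 1) ((hprod.comp Sigma.fst).mono fun x => prod_range_le hR x.1 x.2.2.le)
      fun _ _ hs => hs.2.2
  obtain ⟨p, T, hT, hp⟩ :=
    PolyTime.setNat (C.free + 1) (hvar.add (.lit 1)) (hcell.mul (hRb.extend _))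
  refine ⟨p, T, hT, fun x s hs => ?_⟩
  simp only [prod_range_succ]
  exact hp x s ⟨hs.1.1, hs.1.2, hs.2⟩

theorem PolyTime.prodTable (hb : IsIndex C b) (hR : ∀ γ l, 0 < R γ l)
    (hRb : IsIndex (C.push b) fun x => R x.1 x.2)
    (hprod : PolyBounded C.size fun γ => ∏ l ∈ range (b γ), R γ l) :
    PolyTime C.size C.Represents fun γ _ s' => (C.prodTable b R).Represents γ s' := by
  have hnotMem : C.free + 1 ∉ Set.Iio C.free := fun h => by
    have := Set.mem_Iio.1 h
    omega
  have hloop := PolyTime.forLoop hb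
    (pre := fun γ s => C.Represents γ s ∧ s.nat (C.free + 1) 0 = 1) (fun _ _ hs => hs.1)
    (prodTable_succ hb hR hRb hprod)
    (fun γ s i σ => (∀ k ≤ i, σ.nat (C.free + 1) k = ∏ l ∈ range k, R γ l) ∧
      Agree (Set.Iio C.free) Set.univ s σ)
    (fun γ s hs => ⟨fun k hk => by rw [Nat.le_zero.1 hk, hs.2, prod_range_zero], .refl _ _ s⟩)
    (fun γ s i σ hs h => ⟨(hs.1.congr_of_agree h.2).push i, ?_⟩) ?_
  · have hinit := PolyTime.setNat (C.free + 1) (.lit (C := C) 0) (.lit 1)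
    refine (hinit.seq hloop ?_).imp ?_
    · rintro γ s _ hs rfl
      exact ⟨hs.congr_of_agree ((Agree.refl _ _ s).writeNat hnotMem 0 1),
        nat_writeNat_self _ _ _ _⟩
    · rintro γ s s' hs ⟨_, rfl, htab, hag⟩
      have hs' : C.Represents γ s' :=
        hs.congr_of_agree (((Agree.refl _ _ s).writeNat hnotMem 0 1).trans hag)
      exact ⟨hs'.1, ⟨hs'.2, trivial⟩, htab⟩
  · rw [nat_writeNat_of_ne _ (Nat.succ_ne_self _)]
    exact h.1 i le_rfl
  · rintro γ s i σ _ - h rfl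
    refine ⟨fun k hk => ?_, (h.2.writeNat Set.self_notMem_Iio 0 i).writeNat hnotMem _ _⟩
    rcases hk.eq_or_lt with rfl | hk
    · exact nat_writeNat_self _ _ _ _
    · rw [nat_writeNat_of_index_ne _ _ hk.ne, nat_writeNat_of_ne _ (Nat.succ_ne_self _)]
      exact h.1 k (Nat.lt_succ_iff.1 hk)

theorem PolyTime.fillNat {a : ℕ} (ha : a ∈ ({2, 3} : Set ℕ)) (hb : IsIndex C b)
    (hg : IsIndex (C.push b) fun x => F x.1 x.2) :
    PolyTime C.size C.Represents fun γ s s' =>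
      (∀ x < b γ, s'.nat a x = F γ x) ∧ Agree (Set.Iio C.free \ {a}) Set.univ s s' := by
  have hcongr {γ : Γ} {s s' : State} (hs : C.Represents γ s)
      (h : Agree (Set.Iio C.free \ {a}) Set.univ s s') : C.Represents γ s' :=
    hs.congr (h.mono (fun c hc => ⟨hc.1, fun h => hc.2 (h ▸ ha)⟩) (Set.subset_univ _))
  refine PolyTime.forLoop hb (fun _ _ hs => hs) (PolyTime.setNat a (.var hb) hg)
    (fun γ s i σ => (∀ x < i, σ.nat a x = F γ x) ∧ Agree (Set.Iio C.free \ {a}) Set.univ s σ)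
    (fun _ s _ => ⟨fun x hx => absurd hx (Nat.not_lt_zero x), .refl _ _ s⟩)
    (fun γ s i σ hs h => (hcongr hs h.2).push i) ?_
  rintro γ s i σ _ - h rfl
  refine ⟨fun x hx => ?_, (h.2.writeNat (fun h => Set.self_notMem_Iio h.1) 0 i).writeNat
    (fun h => h.2 rfl) _ _⟩
  rcases (Nat.lt_succ_iff.1 hx).eq_or_lt with rfl | hx
  · exact nat_writeNat_self _ _ _ _
  · rw [nat_writeNat_of_index_ne _ _ hx.ne,
      nat_writeNat_of_ne _ (ne_of_mem_of_not_mem ha C.free_notMem)]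
    exact h.1 x hx

theorem PolyTime.fillNum {f : Γ → ℕ → ℂ} (hb : IsIndex C b)
    (hf : Computes (C.push b) 0 fun x => f x.1 x.2) :
    PolyTime C.size C.Represents fun γ s s' =>
      (∀ x < b γ, s'.num 1 x = f γ x) ∧ Agree (Set.Iio C.free) {0} s s' := by
  have hcopy := PolyTime.setNum 1 (.var hb) (.load 2 (.lit 0)) (.const _ 2)
    fun _ _ _ => le_rfl
  have hbody := hf.seq hcopy fun _ _ _ hs h => Computes.represents hs h.2
  refine PolyTime.forLoop hb (fun _ _ hs => hs) hbody
    (fun γ s i σ => (∀ x < i, σ.num 1 x = f γ x) ∧ Agree (Set.Iio C.free) {0} s σ)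
    (fun _ s _ => ⟨fun x hx => absurd hx (Nat.not_lt_zero x), .refl _ _ s⟩)
    (fun γ s i σ hs h => (hs.congr (h.2.mono Set.sdiff_subset le_rfl)).push i) ?_
  rintro γ s i σ _ - h ⟨σ', ⟨hval, hag⟩, rfl⟩
  refine ⟨fun x hx => ?_, ?_⟩
  · rcases (Nat.lt_succ_iff.1 hx).eq_or_lt with rfl | hx
    · exact (num_writeNum_self _ _ _ _).trans hval
    · rw [num_writeNum_of_index_ne _ _ hx.ne, hag.num (Nat.lt_succ_self 1)]
      exact h.1 x hx
  · have hag' := hag.mono (Set.Iio_subset_Iio (Nat.le_succ C.free))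
      (Set.singleton_subset_iff.2 (Nat.succ_pos 1))
    exact (((h.2.writeNat Set.self_notMem_Iio 0 i).trans hag')).writeNum
      (fun h => one_ne_zero (Set.mem_singleton_iff.1 h)) _ _

end Tables

/-- In the context `C`, the number of modes `m` is known, and there are tables of the cutoffs `N`
and of the place values of the mixed radix systems for multi-indices and for monomials. -/
structure HasTables {Γ : Type*} (C : Context Γ) (m : Γ → ℕ) (N : Γ → ℕ → ℕ) : Prop where
  modes : IsIndex C m
  cutoff : Tabulates C m N
  indices : Tabulates C (fun γ => m γ + 1) fun γ k => ∏ l ∈ range k, (N γ l + 1)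
  monomials : Tabulates C (fun γ => m γ + m γ + 1) fun γ k =>
    ∏ l ∈ range k, radix (m γ) (N γ) l

namespace HasTables

variable {Γ : Type*} {C : Context Γ} {m b i j k t : Γ → ℕ} {N : Γ → ℕ → ℕ} {r : ℕ}

theorem weaken (h : HasTables C m N) :
    HasTables (C.push b) (fun x => m x.1) fun x => N x.1 where
  modes := h.modes.weaken
  cutoff := h.cutoff.weaken
  indices := h.indices.weaken
  monomials := h.monomials.weaken

theorem isIndex_prod (h : HasTables C m N) :
    IsIndex C fun γ => ∏ l ∈ range (m γ), (N γ l + 1) :=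
  h.indices.isIndex h.modes fun _ => Nat.lt_succ_self _

theorem isIndex_digit (h : HasTables C m N) (hi : IsIndex C i) (hk : IsIndex C k)
    (hkm : ∀ γ, k γ < m γ) : IsIndex C fun γ => digit (fun l => N γ l + 1) (i γ) (k γ) :=
  .digit h.indices hi hk (fun γ => (hkm γ).trans (Nat.lt_succ_self _))
    ((h.cutoff.isIndex hk hkm).add (.lit 1))

theorem isIndex_digit_radix (h : HasTables C m N) (ht : IsIndex C t) (hk : IsIndex C k)
    (hkm : ∀ γ, k γ < m γ + m γ) : IsIndex C fun γ => digit (radix (m γ) (N γ)) (t γ) (k γ) :=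
  .digit h.monomials ht hk (fun γ => (hkm γ).trans (Nat.lt_succ_self _))
    (.radix h.modes h.cutoff hk hkm)

theorem computes_prod_modeCoeff (h : HasTables C m N) (hi : IsIndex C i) (hj : IsIndex C j)
    (ht : IsIndex C t) :
    Computes C r fun γ => ∏ k ∈ range (m γ), modeCoeff (N γ k)
      (digit (fun l => N γ l + 1) (i γ) k) (digit (fun l => N γ l + 1) (j γ) k)
      (digit (radix (m γ) (N γ)) (t γ) k) (digit (radix (m γ) (N γ)) (t γ) (m γ + k)) := by
  have hk := IsIndex.var h.modes
  have h' := h.weaken (b := m)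
  exact .prod h.modes (.modeCoeff (h'.cutoff.isIndex hk fun x => x.2.2)
    (h'.isIndex_digit hi.weaken hk fun x => x.2.2) (h'.isIndex_digit hj.weaken hk fun x => x.2.2)
    (h'.isIndex_digit_radix ht.weaken hk fun x => x.2.2.trans_le le_add_self)
    (h'.isIndex_digit_radix ht.weaken (h'.modes.add hk) fun x => Nat.add_lt_add_left x.2.2 _))

theorem computes_coeffAt (h : HasTables C m N) (ht : IsIndex C t) :
    Computes C r fun γ => coeffAt (m γ) (N γ) (C.input γ) (t γ) := by
  let d γ := ∏ l ∈ range (m γ), (N γ l + 1)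
  have hd : IsIndex C d := h.isIndex_prod
  have hi := IsIndex.var hd
  have hj := IsIndex.var (hd.weaken (b := d))
  exact .sum hd (.sum hd.weaken (.mul (.input ((hi.weaken.mul hd.weaken.weaken).add hj))
    (h.weaken.weaken.computes_prod_modeCoeff hi.weaken hj ht.weaken.weaken)))

theorem polyTime_output (h : HasTables C m N) :
    PolyTime C.size C.Represents fun γ s s' =>
      s'.nat 2 0 = ∏ l ∈ range (m γ + m γ), radix (m γ) (N γ) l ∧
      (∀ x < s'.nat 2 0 * (m γ + m γ),
        s'.nat 3 x = digit (radix (m γ) (N γ)) (x / (m γ + m γ)) (x % (m γ + m γ))) ∧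
      ∀ t < s'.nat 2 0, s'.num 1 t = coeffAt (m γ) (N γ) (s.num 0) t := by
  have hm := h.modes.add h.modes
  have hM := h.monomials.isIndex hm fun _ => Nat.lt_succ_self _
  have hx := IsIndex.var (hM.mul hm)
  have hcount := PolyTime.setNat 2 (.lit (C := C) 0) hM
  have hexp := PolyTime.fillNat (Or.inr rfl) (hM.mul hm)
    (F := fun γ x => digit (radix (m γ) (N γ)) (x / (m γ + m γ)) (x % (m γ + m γ)))
    (h.weaken.isIndex_digit_radix (hx.div hm.weaken) (hx.mod hm.weaken) fun x =>
      Nat.mod_lt _ (Nat.pos_of_mul_pos_left (Nat.zero_lt_of_lt x.2.2)))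
  have hcoeff := PolyTime.fillNum hM (f := fun γ t => coeffAt (m γ) (N γ) (C.input γ) t)
    (h.weaken.computes_coeffAt (.var hM))
  have hfree := C.four_le_free
  refine (hcount.seq (hexp.seq hcoeff fun γ s s' hs hs' => ?_) fun γ s s' hs hs' => ?_).imp
    fun γ s s' hs hs' => ?_
  · exact hs.congr (hs'.2.mono (Set.sdiff_subset_sdiff_right (by simp)) (Set.subset_univ _))
  · exact hs.congr (hs' ▸ (Agree.refl _ _ s).writeNat (by simp) _ _)
  · obtain ⟨s₁, rfl, s₂, ⟨hexps, hs₂⟩, hcoeffs, hs'⟩ := hs'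
    have hcount' : s'.nat 2 0 = ∏ l ∈ range (m γ + m γ), radix (m γ) (N γ) l := by
      rw [hs'.nat (Set.mem_Iio.2 (by omega)), hs₂.nat ⟨Set.mem_Iio.2 (by omega), by simp⟩,
        nat_writeNat_self]
    rw [hcount', hs.1, hs'.nat (Set.mem_Iio.2 (by omega))]
    exact ⟨rfl, hexps, hcoeffs⟩

end HasTables

/-- The data described by an input state, as they stand in the arrays: the number of modes, the
cutoffs (followed by arbitrary entries), and the list of the matrix entries. -/
structure InputData where
  modes : ℕ
  cutoff : ℕ → ℕ
  matrix : ℕ → ℂ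

/-- The context in which the input data have not been overwritten. -/
def inputContext : Context InputData where
  size x := x.modes + ∏ l ∈ range x.modes, (x.cutoff l + 1)
  input x := x.matrix
  free := 4
  Holds x f := f 0 0 = x.modes ∧ f 1 = x.cutoff
  four_le_free := le_rfl
  holds_congr h hf := by
    rw [h (by simp), h (by simp)]
    exact hf

/-- The context in which the tables of place values have been computed. -/
def tableContext : Context InputData :=
  (inputContext.prodTable InputData.modes fun x l => x.cutoff l + 1).prodTable
    (fun x => x.modes + x.modes) fun x => radix x.modes x.cutoff

theorem isIndex_modes : IsIndex inputContext InputData.modes :=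
  .load 0 (.lit 0) ((PolyBounded.self _).mono fun _ => Nat.le_add_right _ _) fun _ _ hs => hs.2.1

theorem tabulates_cutoff : Tabulates inputContext InputData.modes InputData.cutoff := by
  refine ⟨⟨1, fun _ _ hs k _ => congrFun hs.2.2 k⟩, ⟨_, .self _, fun x k hk => ?_⟩⟩
  calc x.cutoff k ≤ x.cutoff k + 1 := Nat.le_succ _
    _ ≤ ∏ l ∈ range x.modes, (x.cutoff l + 1) :=
      single_le_prod' (fun _ _ => Nat.le_add_left _ _) (mem_range.2 hk)
    _ ≤ _ := Nat.le_add_left _ _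

theorem polyBounded_prod : PolyBounded inputContext.size fun x =>
    ∏ l ∈ range x.modes, (x.cutoff l + 1) :=
  (PolyBounded.self _).mono fun _ => Nat.le_add_left _ _

theorem polyBounded_prod_radix : PolyBounded inputContext.size fun x =>
    ∏ l ∈ range (x.modes + x.modes), radix x.modes x.cutoff l :=
  ⟨.X ^ 6, fun x => by
    rw [Polynomial.eval_pow, Polynomial.eval_X]
    exact (prod_radix_le x.cutoff x.modes).trans
      (Nat.pow_le_pow_left (Nat.le_add_left _ _) 6)⟩

theorem hasTables_tableContext : HasTables tableContext InputData.modes InputData.cutoff where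
  modes := isIndex_modes.prodTable.prodTable
  cutoff := tabulates_cutoff.prodTable.prodTable
  indices := (tabulates_prodTable (fun _ _ => Nat.succ_pos _) polyBounded_prod).prodTable
  monomials := tabulates_prodTable (fun _ => radix_pos _ _) polyBounded_prod_radix

theorem polyTime_tables :
    PolyTime inputContext.size inputContext.Represents fun x _ => tableContext.Represents x := by
  have hindices := PolyTime.prodTable isIndex_modes (R := fun x l => x.cutoff l + 1)
    (fun _ _ => Nat.succ_pos _)
    ((tabulates_cutoff.weaken.isIndex (.var isIndex_modes) fun x => x.2.2).add (.lit 1))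
    polyBounded_prod
  have hm := isIndex_modes.prodTable (b := InputData.modes) (R := fun x l => x.cutoff l + 1)
  have hmonomials := PolyTime.prodTable (hm.add hm)
    (R := fun x : InputData => radix x.modes x.cutoff) (fun x => radix_pos x.modes x.cutoff)
    (.radix hm.weaken tabulates_cutoff.prodTable.weaken (.var (hm.add hm)) fun x => x.2.2)
    polyBounded_prod_radix
  exact (hindices.seq hmonomials fun _ _ _ _ h => h).imp fun _ _ _ _ ⟨_, _, h⟩ => h

theorem exists_prog_interpolationPoly :
    ∃ (prog : Prog) (c : ℕ), ∀ (m : ℕ) (N : Fin m → ℕ) (H : cutoffSpace N →L[ℂ] cutoffSpace N)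
      (s : State), IsInput H s →
        IsOutput (interpolationPoly H) (prog.exec s) ∧
        prog.time s ≤ c * (m + ∏ k, (N k + 1)) ^ c := by
  obtain ⟨prog, T, hT, hprog⟩ :=
    polyTime_tables.seq hasTables_tableContext.polyTime_output fun _ _ _ _ h => h
  obtain ⟨c, hc⟩ := hT.exists_le_mul_pow fun x =>
    (prod_pos fun _ _ => Nat.succ_pos _).trans_le (Nat.le_add_left _ x.modes)
  refine ⟨prog, c, fun m N H s hs => ?_⟩
  obtain rfl : (fun k : Fin m => s.nat 1 k) = N := funext hs.2.1
  obtain ⟨⟨s₁, hs₁, hcount, hexp, hcoeff⟩, htime⟩ :=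
    hprog ⟨m, s.nat 1, s.num 0⟩ s ⟨rfl, hs.1, rfl⟩
  rw [← prod_range fun l => s.nat 1 l + 1]
  rw [hs₁.1] at hcoeff
  refine ⟨hs.isOutput_interpolationPoly hcount (fun t ht l hl => ?_) hcoeff, htime.trans (hc _)⟩
  have hpos : 0 < m + m := Nat.zero_lt_of_lt hl
  have hx : t * (m + m) + l < (prog.exec s).nat 2 0 * (m + m) :=
    calc t * (m + m) + l < (t + 1) * (m + m) := by rw [Nat.succ_mul]; omega
      _ ≤ _ := Nat.mul_le_mul_right _ ht
  simpa only [mul_comm t, Nat.mul_add_div hpos, Nat.div_eq_of_lt hl, add_zero, Nat.mul_add_mod,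
    Nat.mod_eq_of_lt hl] using hexp _ hx

end RealRAM

/-! ## The theorem -/

theorem theorem2 :
    ∃ (prog : RealRAM.Prog) (c : ℕ),
      ∀ (m : ℕ) (_ : 1 ≤ m) (N : Fin m → ℕ) (H : cutoffSpace N →L[ℂ] cutoffSpace N)
        (_ : (H : cutoffSpace N →ₗ[ℂ] cutoffSpace N).IsSymmetric),
      ∃ P : MvPolynomial (Fin m ⊕ Fin m) ℂ,
        -- degree bound; with only some of the cutoffs equal to `0` it would be `0` and fail
        (((∀ k, N k ≠ 0) ∨ ∀ k, N k = 0) → P.totalDegree ≤ 3 ^ m * ∏ k, N k) ∧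
        -- the explicit form of `P(q,p)`
        polyOp P = interpolationOp H ∧
        -- `P(q,p)` is Hermitian
        IsHermitianOp (toUnbounded (polyOp P)) ∧
        -- `P(q,p) = H ⊕ H'` and `e^{itP(q,p)} = e^{itH} ⊕ e^{itH'}`
        (∃ H' : (cutoffSpace N)ᗮ →ₗ.[ℂ] (cutoffSpace N)ᗮ,
          IsHermitianOp H' ∧
          toUnbounded (polyOp P) = unboundedSum (cutoffSpace N) H H' ∧
          ∀ U : ℝ → FockSpace m →L[ℂ] FockSpace m,
            IsEvolution (toUnbounded (polyOp P)) U ↔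
              ∃ U' : ℝ → (cutoffSpace N)ᗮ →L[ℂ] (cutoffSpace N)ᗮ, IsEvolution H' U' ∧
                ∀ t : ℝ, U t = boundedSum (cutoffSpace N)
                  (expI H t) (U' t)) ∧
        -- `e^{itP(q,p)} ψ = e^{itH} ψ` on the truncated space
        (∀ U : ℝ → FockSpace m →L[ℂ] FockSpace m,
          IsEvolution (toUnbounded (polyOp P)) U → ∀ (ψ : cutoffSpace N) (t : ℝ),
            U t ψ = expI H t ψ) ∧
        -- `e^{itH} ψ` is the unique solution of the Schrödinger equation of `P(q,p)` starting at `ψ`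
        (∀ (ψ : cutoffSpace N) (φ : ℝ → FockSpace m),
          (φ 0 = ψ ∧ SolvesSchrodinger (toUnbounded (polyOp P)) φ) ↔
            ∀ t : ℝ, φ t = expI H t ψ) ∧
        -- `P` is computed in time polynomial in the size of the input
        ∀ s : RealRAM.State, RealRAM.IsInput H s →
          RealRAM.IsOutput P (prog.exec s) ∧
          prog.time s ≤ c * (m + ∏ k, (N k + 1)) ^ c := by
  obtain ⟨prog, c, hprog⟩ := RealRAM.exists_prog_interpolationPoly
  refine ⟨prog, c, fun m _ N H hH => ⟨interpolationPoly H,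
    totalDegree_interpolationPoly_le_prod H, polyOp_interpolationPoly H, ?_⟩⟩
  rw [polyOp_interpolationPoly H]
  have hA : IsHermitianOp (toUnbounded (interpolationOp H)) :=
    isHermitianOp_toUnbounded (interpolationOp_conj hH)
  obtain ⟨H', hH', hsum⟩ : ∃ H', IsHermitianOp H' ∧
      toUnbounded (interpolationOp H) = unboundedSum (cutoffSpace N) H H' :=
    ⟨_, isHermitianOp_orthogonalCompression hA (toUnbounded_interpolationOp_of_mem H),
      eq_unboundedSum_orthogonalCompression hA.2 (toUnbounded_interpolationOp_of_mem H)⟩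
  rw [hsum] at hA ⊢
  exact ⟨hA, ⟨H', hH', rfl, fun _ => isEvolution_unboundedSum_iff hH⟩,
    fun _ hU => hU.apply_coe, solvesSchrodinger_unboundedSum_iff hA.2, hprog m N H⟩
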